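/- Let $F$ be a field and $n\ge 2$. For $Q,a,b,c\in F$, $Q\neq 0$, consider the unital associative $F$-algebra with invertible generators $g_1,\dots,g_{n-1}$, a generator $e$, and relations: $g_i^2=(Q-1)g_i+Q$, $g_ig_{i+1}g_i=g_{i+1}g_ig_{i+1}$, $g_ig_j=g_jg_i$ for $|i-j|\ge 2$; $e^2=ae$; $eg_i=g_ie$ for $i>2$, $eg_1=g_1e=Qe$, $eg_2e=be$, $eg_2^{-1}e=ce$; and $w e_{(2)}=e_{(2)}w$ with $w=g_2g_3g_1^{-1}g_2^{-1}$, $e_{(2)}=ewe$ (relations involving a $g_i$ with $i\ge n$ are omitted). * $Br_n(r^2,q^2)$ is the case $Q=q^2$, $a=\frac{r-r^{-1}}{q-q^{-1}}$, $b=rq$, $c=(rq)^{-1}$; its parameters satisfy $r,\ q,\ q-q^{-1},\ r-r^{-1}\neq 0$. * $Br_n(r,q)$ is the case $Q=q$, $a=\frac{r-1}{q-1}$, $b=r$, $c=q^{-1}$; its parameters satisfy $r,\ q,\ q-1,\ r-1\neq 0$. For $r,q\in F\setminus\{0\}$ the BMW-algebra $\mathscr B_n=\mathscr B_n(r,q)$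 is the unital associative $F$-algebra with invertible generators $T_1,\dots,T_{n-1}$ satisfying the braid relations $T_iT_{i+1}T_i=T_{i+1}T_iT_{i+1}$, $T_iT_j=T_jT_i$ ($|i-j|\ge2$), and $E_iT_i=r^{-1}E_i$, $E_iT_j^{\pm1}E_i=r^{\pm1}E_i$ for $|i-j|=1$, where $(q-q^{-1})(1-E_i)=T_i-T_i^{-1}$ defines $E_i$ when $q\neq q^{-1}$. For $q=q^{-1}$, where only $n=2$ is needed, the relation used is its denominator-free form, so that for all $r,q\ne0$ one has $\mathscr B_2=F[T]/\big((T-q)(T+q^{-1})(T-r^{-1})\big)$. **Claim 1.1.** In general there is no $F$-algebra isomorphism between $Br_n(r^2,q^2)$ and $\mathscr B_n(r,q)$, nor between $Br_n(r,q)$ and $\mathscr B_n(r,q)$: it is not true that these algebras are isomorphic for all $n\ge 2$, all fields $F$ and all $r,q\in F$ for which both are defined (with $q\ne q^{-1}$). More precisely: 1. Let $F=\mathbb C$, $n=3$, $q^2=-i$ and $r=q^{-1}$. Then $(r,q)$ is a parameter pair of $Br_3(r^2,q^2)$, the algebra $Br_3(r^2,q^2)$ is semisimple, $\mathscr B_3(r,q)$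 is not semisimple, and the two are not isomorphic as $\mathbb C$-algebras. 2. Let $F=\mathbb C$, $n=3$, $q=i\sqrt i$ (for either square root of $i$) and $r=q^{-1}$. Then $(r,q)$ is a parameter pair of $Br_3(r,q)$ and $q\neq q^{-1}$, the algebra $Br_3(r,q)$ is semisimple, $\mathscr B_3(r,q)$ is not semisimple, and the two are not isomorphic as $\mathbb C$-algebras. 3. Let $F=\mathbb F_5$ and $n=2$. The pairs $(r,q)$ of nonzero elements for which $\mathscr B_2(r,q)$ is not semisimple are exactly those in $(\{1,2,3,4\}\times\{2,3\})\cup(\{1,4\}\times\{1,4\})$, twelve in number (eight of them with $q\ne q^{-1}$). The parameter pairs $(r,q)$ for which $Br_2(r^2,q^2)$ is not semisimple are exactly the four in $\{2,3\}\times\{2,3\}$, and those for which $Br_2(r,q)$ is not semisimple are exactly the three in $\{2,3,4\}\times\{4\}$. -/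

import Mathlib

/-- The generators `g_1, …, g_{n-1}` of the `q`-Brauer algebra (`g i` stands for `g_{i+1}`), formal
symbols for their inverses, and the generator `e`. The algebra is considered for `n ≥ 2`. -/
inductive QBrauerGen (n : ℕ) : Type
  | g (i : Fin (n - 1))
  | gInv (i : Fin (n - 1))
  | e

namespace QBrauerGen

variable (F : Type*) [Field F] {n : ℕ}

/-- `g_{i+1}` in the free algebra. -/
abbrev G (i : Fin (n - 1)) : FreeAlgebra F (QBrauerGen n) := FreeAlgebra.ι F (g i)

/-- `g_{i+1}⁻¹` in the free algebra. -/
abbrev GI (i : Fin (n - 1)) : FreeAlgebra F (QBrauerGen n) := FreeAlgebra.ι F (gInv i)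

/-- `e` in the free algebra. -/
abbrev E (n : ℕ) : FreeAlgebra F (QBrauerGen n) := FreeAlgebra.ι F e

/-- The element `g_2 g_3 g_1⁻¹ g_2⁻¹`, where `i, j, k` are the indices of `g_1, g_2, g_3`. -/
abbrev W (i j k : Fin (n - 1)) : FreeAlgebra F (QBrauerGen n) :=
  G F j * G F k * GI F i * GI F j

end QBrauerGen

open QBrauerGen in
/-- The defining relations common to the two versions of the `q`-Brauer algebra: `Q` is the
parameter of the Hecke algebra, `e² = a e`, `e g_2 e = b e` and `e g_2⁻¹ e = c e`.
(Indices are shifted by one: `g_1` is the generator with `i.val = 0`.) -/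
inductive QBrauerRel {F : Type*} [Field F] (n : ℕ) (Q a b c : F) :
    FreeAlgebra F (QBrauerGen n) → FreeAlgebra F (QBrauerGen n) → Prop
  | g_gInv (i : Fin (n - 1)) : QBrauerRel n Q a b c (G F i * GI F i) 1
  | gInv_g (i : Fin (n - 1)) : QBrauerRel n Q a b c (GI F i * G F i) 1
  | hecke_quadratic (i : Fin (n - 1)) :
      QBrauerRel n Q a b c (G F i * G F i) ((Q - 1) • G F i + Q • 1)
  | hecke_braid (i j : Fin (n - 1)) (hij : j.val = i.val + 1) :
      QBrauerRel n Q a b c (G F i * G F j * G F i) (G F j * G F i * G F j)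
  | hecke_comm (i j : Fin (n - 1)) (hij : i.val + 2 ≤ j.val) :
      QBrauerRel n Q a b c (G F i * G F j) (G F j * G F i)
  | e_sq : QBrauerRel n Q a b c (E F n * E F n) (a • E F n)
  | e_comm (i : Fin (n - 1)) (hi : 2 ≤ i.val) :
      QBrauerRel n Q a b c (E F n * G F i) (G F i * E F n)
  | e_g_one (i : Fin (n - 1)) (hi : i.val = 0) :
      QBrauerRel n Q a b c (E F n * G F i) (Q • E F n)
  | g_one_e (i : Fin (n - 1)) (hi : i.val = 0) :
      QBrauerRel n Q a b c (G F i * E F n) (Q • E F n)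
  | e_g_two_e (i : Fin (n - 1)) (hi : i.val = 1) :
      QBrauerRel n Q a b c (E F n * G F i * E F n) (b • E F n)
  | e_gInv_two_e (i : Fin (n - 1)) (hi : i.val = 1) :
      QBrauerRel n Q a b c (E F n * GI F i * E F n) (c • E F n)
  | e_two (i j k : Fin (n - 1)) (hi : i.val = 0) (hj : j.val = 1) (hk : k.val = 2) :
      QBrauerRel n Q a b c (W F i j k * (E F n * W F i j k * E F n))
        ((E F n * W F i j k * E F n) * W F i j k)

/-- The `q`-Brauer algebra `Br_n(r², q²)` over the field `F`: Hecke parameter `q²`,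
`e² = (r - r⁻¹)/(q - q⁻¹) e`, `e g_1 = g_1 e = q² e`, `e g_2 e = r q e`,
`e g_2⁻¹ e = (r q)⁻¹ e`. -/
abbrev QBrauerSq {F : Type*} [Field F] (n : ℕ) (r q : F) : Type _ :=
  RingQuot (QBrauerRel n (q ^ 2) ((r - r⁻¹) / (q - q⁻¹)) (r * q) (r * q)⁻¹)

/-- The `q`-Brauer algebra `Br_n(r, q)` over the field `F`: Hecke parameter `q`,
`e² = (r - 1)/(q - 1) e`, `e g_1 = g_1 e = q e`, `e g_2 e = r e`, `e g_2⁻¹ e = q⁻¹ e`. -/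
abbrev QBrauer {F : Type*} [Field F] (n : ℕ) (r q : F) : Type _ :=
  RingQuot (QBrauerRel n q ((r - 1) / (q - 1)) r q⁻¹)

/-- Parameters of `Br_n(r², q²)`: `r`, `q` and `(r - r⁻¹)/(q - q⁻¹)` are defined and invertible. -/
def QBrauerSqParam {F : Type*} [Field F] (r q : F) : Prop :=
  r ≠ 0 ∧ q ≠ 0 ∧ q - q⁻¹ ≠ 0 ∧ r - r⁻¹ ≠ 0

/-- Parameters of `Br_n(r, q)`: `r`, `q` and `(r - 1)/(q - 1)` are defined and invertible. -/
def QBrauerParam {F : Type*} [Field F] (r q : F) : Prop :=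
  r ≠ 0 ∧ q ≠ 0 ∧ q - 1 ≠ 0 ∧ r - 1 ≠ 0

/-- The generators `T_1, …, T_{n-1}` of the Birman–Murakami–Wenzl algebra (`t i` stands for
`T_{i+1}`) and formal symbols for their inverses. -/
inductive BMWGen (n : ℕ) : Type
  | t (i : Fin (n - 1))
  | tInv (i : Fin (n - 1))

namespace BMWGen

variable {F : Type*} [Field F] {n : ℕ}

/-- `T_{i+1}` in the free algebra. -/
abbrev T (F : Type*) [Field F] (i : Fin (n - 1)) : FreeAlgebra F (BMWGen n) :=
  FreeAlgebra.ι F (t i)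

/-- `T_{i+1}⁻¹` in the free algebra. -/
abbrev TI (F : Type*) [Field F] (i : Fin (n - 1)) : FreeAlgebra F (BMWGen n) :=
  FreeAlgebra.ι F (tInv i)

/-- The element `(q - q⁻¹) E_i = (q - q⁻¹) - (T_i - T_i⁻¹)`, that is, the tangle element
`E_i = 1 - (q - q⁻¹)⁻¹ (T_i - T_i⁻¹)` with its denominator cleared. -/
abbrev wE (q : F) (i : Fin (n - 1)) : FreeAlgebra F (BMWGen n) :=
  (q - q⁻¹) • 1 - (T F i - TI F i)

end BMWGen

open BMWGen in
/-- The defining relations of the Birman–Murakami–Wenzl algebra: the `T_i` are invertible, the braid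
relations hold, `E_i T_i = r⁻¹ E_i`, and `E_i T_j^{±1} E_i = r^{±1} E_i` for `|i - j| = 1`.
The last two relations are multiplied by `(q - q⁻¹)` and `(q - q⁻¹)²`, so that no denominator occurs;
for `q ≠ q⁻¹` this changes nothing. Multiplied by `T_i`, the relation `untwist` reads
`(T_i - q) (T_i + q⁻¹) (T_i - r⁻¹) = 0`. -/
inductive BMWRel {F : Type*} [Field F] (n : ℕ) (r q : F) :
    FreeAlgebra F (BMWGen n) → FreeAlgebra F (BMWGen n) → Prop
  | t_tInv (i : Fin (n - 1)) : BMWRel n r q (T F i * TI F i) 1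
  | tInv_t (i : Fin (n - 1)) : BMWRel n r q (TI F i * T F i) 1
  | braid (i j : Fin (n - 1)) (hij : j.val = i.val + 1) :
      BMWRel n r q (T F i * T F j * T F i) (T F j * T F i * T F j)
  | comm (i j : Fin (n - 1)) (hij : i.val + 2 ≤ j.val) :
      BMWRel n r q (T F i * T F j) (T F j * T F i)
  | untwist (i : Fin (n - 1)) : BMWRel n r q (wE q i * T F i) (r⁻¹ • wE q i)
  | tangle (i j : Fin (n - 1)) (hij : j.val = i.val + 1 ∨ i.val = j.val + 1) :
      BMWRel n r q (wE q i * T F j * wE q i) ((r * (q - q⁻¹)) • wE q i)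
  | tangle_inv (i j : Fin (n - 1)) (hij : j.val = i.val + 1 ∨ i.val = j.val + 1) :
      BMWRel n r q (wE q i * TI F j * wE q i) ((r⁻¹ * (q - q⁻¹)) • wE q i)

/-- The Birman–Murakami–Wenzl algebra `𝓑_n` over the field `F` with nonzero parameters `r`, `q`,
normally used for `q ≠ q⁻¹`. For `q = q⁻¹` and `n = 2` it is still the algebra
`F[T] / ((T - q) (T + q⁻¹) (T - r⁻¹))`. -/
abbrev BMW {F : Type*} [Field F] (n : ℕ) (r q : F) : Type _ :=
  RingQuot (BMWRel n r q)

instance fact_prime_five_for_zmod : Fact (Nat.Prime 5) := ⟨by norm_num⟩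

/-! Semisimplicity is an isomorphism invariant, so each non-isomorphism follows once one algebra is
semisimple and the other is not.

For `r = q⁻¹` both three-strand q-Brauer algebras have `a = -b` and `c = b`, so
`QBrauerRel.isSemisimpleRing_three` treats them together. The algebra is the sum of a Hecke part
spanned by 6 elements and the ideal of `e` spanned by 9 elements `x_i e y_j`. The trivial, sign and
two-dimensional Hecke representations separate the first part. On the cell module with basis `x_i
e`, the element `x_i e y_j` acts as a matrix unit times the Gram matrix, whose determinant is `b ^ 3
* Q ^ 2 * (1 + Q) ^ 2`, so the cell module separates the second part. All four representations are
onto matrix algebras, hence kill the Jacobson radical, which is therefore zero.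

On the BMW side (`BMWRel.not_isSemisimpleRing_three`), the three-dimensional cell module has an
invariant line `F v` when `q ^ 4 = -1`, and `E₁ v = 0`. Some element acts as `v wᵀ ≠ 0` with `wᵀ v =
0`, where `wᵀ` is the nonzero row of `(q - q⁻¹) E₁`. Then `x y x` acts as zero for every `y`, which
is impossible in a semisimple ring, where `x = x y x` is solvable.

For two strands both algebras are commutative and spanned by three elements. Three distinct
characters give semisimplicity; a coincidence of eigenvalues gives a map to the dual numbers that
hits `ε`. Over the field with five elements the rest is a finite check. -/

/-- In a semisimple ring every element `x` can be written as `x * y * x`. -/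
theorem exists_mul_mul_eq_of_isSemisimpleRing {A : Type*} [Ring A] [IsSemisimpleRing A] (x : A) :
    ∃ y, x * y * x = x := by
  obtain ⟨e, he, hI⟩ := IsSemisimpleRing.ideal_eq_span_idempotent (Ideal.span {x})
  obtain ⟨y, hy⟩ := Ideal.mem_span_singleton'.1 (hI ▸ Ideal.mem_span_singleton_self e)
  obtain ⟨z, hz⟩ := Ideal.mem_span_singleton'.1 (hI ▸ Ideal.mem_span_singleton_self x)
  -- The left ideal of `x` is that of the idempotent `e`, so `e = y x` and `x = z e`; hence `x y x =
  -- z e e = x`.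
  exact ⟨y, by rw [mul_assoc, hy, ← hz, mul_assoc, he.eq]⟩

/-- A ring is not semisimple if in some image a nonzero element `ρ x` satisfies
`ρ x * ρ y * ρ x = 0` for all `y`. -/
theorem not_isSemisimpleRing_of_forall_mul_mul_eq_zero {A B : Type*} [Ring A] [Ring B]
    (ρ : A →+* B) (x : A) (hx : ρ x ≠ 0) (h : ∀ y, ρ x * ρ y * ρ x = 0) :
    ¬ IsSemisimpleRing A := fun _ => by
  obtain ⟨y, hy⟩ := exists_mul_mul_eq_of_isSemisimpleRing x
  exact hx (by rw [← hy, map_mul, map_mul, h])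

/-- A ring with a homomorphism to a commutative ring whose image contains a nonzero element of
square zero is not semisimple. -/
theorem not_isSemisimpleRing_of_mul_self_eq_zero {A B : Type*} [Ring A] [CommRing B]
    (ρ : A →+* B) (x : A) (hx : ρ x ≠ 0) (h : ρ x * ρ x = 0) : ¬ IsSemisimpleRing A :=
  not_isSemisimpleRing_of_forall_mul_mul_eq_zero ρ x hx fun y => by
    rw [mul_right_comm, h, zero_mul]

/-- A surjective homomorphism onto a semisimple ring kills the Jacobson radical. -/
theorem map_eq_zero_of_mem_jacobson {A B : Type*} [Ring A] [Ring B] [IsSemisimpleRing B]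
    (f : A →+* B) (hf : Function.Surjective f) {x : A} (hx : x ∈ Ring.jacobson A) : f x = 0 := by
  have : RingHomSurjective f := ⟨hf⟩
  have h := Ring.le_comap_jacobson f hx
  rwa [Ideal.mem_comap, Ring.jacobson, IsSemisimpleModule.jacobson_eq_bot B B, Submodule.mem_bot] at h

/-- A finite-dimensional algebra is semisimple if its Jacobson radical is zero. -/
theorem isSemisimpleRing_of_jacobson_eq_zero (F : Type*) {A : Type*} [Field F] [Ring A]
    [Algebra F A] [Module.Finite F A] (h : ∀ x ∈ Ring.jacobson A, x = 0) : IsSemisimpleRing A := by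
  have : IsArtinianRing A := IsArtinianRing.of_finite F A
  exact IsArtinianRing.isSemisimpleRing_iff_jacobson.2 ((Submodule.eq_bot_iff _).2 h)

theorem AlgHom.surjective_to_field {F A : Type*} [Field F] [Ring A] [Algebra F A] (χ : A →ₐ[F] F) :
    Function.Surjective χ := fun c => ⟨algebraMap F A c, χ.commutes c⟩

/-! ### Spanning sets of presented algebras -/

/-- A submodule that contains `1` and is stable under left multiplication by algebra generators is
everything. -/
theorem Submodule.eq_top_of_mul_mem {F A : Type*} [Field F] [Ring A] [Algebra F A] {s : Set A}
    (hs : Algebra.adjoin F s = ⊤) (S : Submodule F A) (h1 : (1 : A) ∈ S)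
    (h : ∀ g ∈ s, ∀ x ∈ S, g * x ∈ S) : S = ⊤ := by
  refine (Submodule.eq_top_iff'.2 fun x => ?_)
  suffices ∀ y ∈ S, x * y ∈ S by simpa using this 1 h1
  have hx : x ∈ Algebra.adjoin F s := hs ▸ Algebra.mem_top
  induction hx using Algebra.adjoin_induction with
  | mem g hg => exact h g hg
  | algebraMap c => exact fun y hy => by rw [← Algebra.smul_def]; exact S.smul_mem c hy
  | add a b _ _ ha hb => exact fun y hy => by rw [add_mul]; exact S.add_mem (ha y hy) (hb y hy)
  | mul a b _ _ ha hb => exact fun y hy => by rw [mul_assoc]; exact ha _ (hb y hy)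

/-- A span is stable under left multiplication by `g` if `g` maps the generators into it. -/
theorem Submodule.mul_mem_of_forall_mul_mem {F A ι : Type*} [Field F] [Ring A] [Algebra F A]
    (v : ι → A) (S : Submodule F A) (g : A) (h : ∀ i, g * v i ∈ S) {x : A}
    (hx : x ∈ Submodule.span F (Set.range v)) : g * x ∈ S := by
  have : Submodule.span F (Set.range v) ≤ S.comap (LinearMap.mulLeft F g) :=
    Submodule.span_le.2 (by rintro _ ⟨i, rfl⟩; exact h i)
  exact this hx

/-- The images of the generators generate a presented algebra. -/
theorem adjoin_range_mkAlgHom_ι {F X : Type*} [Field F]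
    (r : FreeAlgebra F X → FreeAlgebra F X → Prop) :
    Algebra.adjoin F (Set.range fun x => RingQuot.mkAlgHom F r (FreeAlgebra.ι F x)) = ⊤ := by
  have h : (Set.range fun x => RingQuot.mkAlgHom F r (FreeAlgebra.ι F x)) =
      RingQuot.mkAlgHom F r '' Set.range (FreeAlgebra.ι F) := by
    rw [← Set.range_comp]; rfl
  rw [h, ← AlgHom.map_adjoin, FreeAlgebra.adjoin_range_ι, Algebra.map_top,
    AlgHom.range_eq_top]
  exact RingQuot.mkAlgHom_surjective F r

/-! ### Three-strand q-Brauer algebra: a spanning set of 15 elements -/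

/-- The relations of the `q`-Brauer algebra on three strands with parameters `Q`, `a = -b`, `b`,
`c = b`. -/
structure QBrauerThreeRel {F A : Type*} [Field F] [Ring A] [Algebra F A] (Q b : F) (g₁ g₂ e : A) :
    Prop where
  sq₁ : g₁ * g₁ = (Q - 1) • g₁ + Q • 1
  sq₂ : g₂ * g₂ = (Q - 1) • g₂ + Q • 1
  braid : g₁ * g₂ * g₁ = g₂ * g₁ * g₂
  e_sq : e * e = -b • e
  e_g₁ : e * g₁ = Q • e
  g₁_e : g₁ * e = Q • e
  e_g₂_e : e * g₂ * e = b • e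

namespace QBrauerThreeRel

section Spanning

variable {F A : Type*} [Field F] [Ring A] [Algebra F A]

/-- The standard basis of the Hecke algebra on three strands. -/
abbrev heckeBasis (g₁ g₂ : A) : Fin 6 → A :=
  ![1, g₁, g₂, g₁ * g₂, g₂ * g₁, g₁ * g₂ * g₁]

/-- The spanning set of the two-sided ideal generated by `e`. -/
abbrev idealBasis (g₁ g₂ e : A) (p : Fin 3 × Fin 3) : A :=
  (![1, g₂, g₁ * g₂] : Fin 3 → A) p.1 * e * (![1, g₂, g₂ * g₁] : Fin 3 → A) p.2

variable {Q b : F} {g₁ g₂ e : A}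

/-- The elements `e, g₂ e, g₁ g₂ e` span a left ideal: `e` absorbs `g₁` on its right side of a word,
and `g₂ g₁ g₂ e = g₁ g₂ g₁ e = Q g₁ g₂ e`. The right factor is carried along unchanged, and `key`
removes it. -/
theorem mul_idealBasis_mem (h : QBrauerThreeRel Q b g₁ g₂ e) {g : A}
    (hg : g = g₁ ∨ g = g₂ ∨ g = e) (p : Fin 3 × Fin 3) :
    g * idealBasis g₁ g₂ e p ∈ Submodule.span F (Set.range (idealBasis g₁ g₂ e)) := by
  obtain ⟨i, j⟩ := p
  have mem (k : Fin 3) : (![1, g₂, g₁ * g₂] : Fin 3 → A) k * e *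
      (![1, g₂, g₂ * g₁] : Fin 3 → A) j ∈ Submodule.span F (Set.range (idealBasis g₁ g₂ e)) :=
    Submodule.subset_span ⟨(k, j), rfl⟩
  have key (c : Fin 3 → F)
      (hc : g * ((![1, g₂, g₁ * g₂] : Fin 3 → A) i * e) =
        c 0 • e + c 1 • (g₂ * e) + c 2 • (g₁ * g₂ * e)) :
      g * idealBasis g₁ g₂ e (i, j) ∈ Submodule.span F (Set.range (idealBasis g₁ g₂ e)) := by
    have h0 := mem 0
    have h1 := mem 1
    have h2 := mem 2
    simp only [Matrix.cons_val, one_mul] at h0 h1 h2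
    have hg : g * idealBasis g₁ g₂ e (i, j) =
        c 0 • (e * (![1, g₂, g₂ * g₁] : Fin 3 → A) j) +
        c 1 • (g₂ * e * (![1, g₂, g₂ * g₁] : Fin 3 → A) j) +
        c 2 • (g₁ * g₂ * e * (![1, g₂, g₂ * g₁] : Fin 3 → A) j) := by
      rw [idealBasis, ← mul_assoc, hc]
      simp only [add_mul, smul_mul_assoc]
    rw [hg]
    exact Submodule.add_mem _ (Submodule.add_mem _ (Submodule.smul_mem _ _ h0)
      (Submodule.smul_mem _ _ h1)) (Submodule.smul_mem _ _ h2)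
  have h₂₁₂ : g₂ * (g₁ * g₂ * e) = Q • (g₁ * g₂ * e) := by
    rw [← mul_assoc, ← mul_assoc, ← h.braid, mul_assoc, h.g₁_e, mul_smul_comm]
  have h₁₁₂ : g₁ * (g₁ * g₂ * e) = Q • (g₂ * e) + (Q - 1) • (g₁ * g₂ * e) := by
    rw [← mul_assoc, ← mul_assoc, h.sq₁]
    simp only [add_mul, smul_mul_assoc, one_mul]
    abel
  have h₂₂ : g₂ * (g₂ * e) = Q • e + (Q - 1) • (g₂ * e) := by
    rw [← mul_assoc, h.sq₂]
    simp only [add_mul, smul_mul_assoc, one_mul]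
    abel
  have he₁₂ : e * (g₁ * g₂ * e) = (Q * b) • e := by
    rw [← mul_assoc, ← mul_assoc, h.e_g₁, smul_mul_assoc, smul_mul_assoc, h.e_g₂_e, smul_smul]
  rcases hg with rfl | rfl | rfl <;> fin_cases i
  · exact key ![Q, 0, 0] (by simp [h.g₁_e])
  · exact key ![0, 0, 1] (by simp [mul_assoc])
  · exact key ![0, Q, Q - 1] (by simpa using h₁₁₂)
  · exact key ![0, 1, 0] (by simp)
  · exact key ![Q, Q - 1, 0] (by simpa using h₂₂)
  · exact key ![0, 0, Q] (by simpa using h₂₁₂)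
  · exact key ![-b, 0, 0] (by simp [h.e_sq])
  · exact key ![b, 0, 0] (by simp [← mul_assoc, h.e_g₂_e])
  · exact key ![Q * b, 0, 0] (by simpa using he₁₂)

theorem mul_heckeBasis_mem (h : QBrauerThreeRel Q b g₁ g₂ e) {g : A}
    (hg : g = g₁ ∨ g = g₂) (i : Fin 6) :
    g * heckeBasis g₁ g₂ i ∈ Submodule.span F (Set.range (heckeBasis g₁ g₂)) := by
  have key (c : Fin 6 → F) (hc : g * heckeBasis g₁ g₂ i = ∑ k, c k • heckeBasis g₁ g₂ k) :
      g * heckeBasis g₁ g₂ i ∈ Submodule.span F (Set.range (heckeBasis g₁ g₂)) :=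
    (Submodule.mem_span_range_iff_exists_fun F).2 ⟨c, hc.symm⟩
  have h₁ (x : A) : g₁ * (g₁ * x) = (Q - 1) • (g₁ * x) + Q • x := by
    rw [← mul_assoc, h.sq₁, add_mul, smul_mul_assoc, smul_mul_assoc, one_mul]
  have h₂ (x : A) : g₂ * (g₂ * x) = (Q - 1) • (g₂ * x) + Q • x := by
    rw [← mul_assoc, h.sq₂, add_mul, smul_mul_assoc, smul_mul_assoc, one_mul]
  have hb : g₂ * (g₁ * g₂) = g₁ * (g₂ * g₁) := by rw [← mul_assoc, ← h.braid, mul_assoc]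
  -- The longest element also has a reduced word starting with `g₂`, so the quadratic relation
  -- applies.
  have hb' : g₂ * (g₁ * (g₂ * g₁)) = (Q - 1) • (g₁ * (g₂ * g₁)) + Q • (g₁ * g₂) := by
    rw [← hb, h₂, hb]
  rcases hg with rfl | rfl <;> fin_cases i
  · exact key ![0, 1, 0, 0, 0, 0] (by simp [Fin.sum_univ_succ])
  · exact key ![Q, Q - 1, 0, 0, 0, 0] (by simp [Fin.sum_univ_succ, h.sq₁, add_comm])
  · exact key ![0, 0, 0, 1, 0, 0] (by simp [Fin.sum_univ_succ])
  · exact key ![0, 0, Q, Q - 1, 0, 0] (by simp [Fin.sum_univ_succ, h₁, add_comm])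
  · exact key ![0, 0, 0, 0, 0, 1] (by simp [Fin.sum_univ_succ, mul_assoc])
  · exact key ![0, 0, 0, 0, Q, Q - 1] (by simp [Fin.sum_univ_succ, mul_assoc, h₁, add_comm])
  · exact key ![0, 0, 1, 0, 0, 0] (by simp [Fin.sum_univ_succ])
  · exact key ![0, 0, 0, 0, 1, 0] (by simp [Fin.sum_univ_succ])
  · exact key ![Q, 0, Q - 1, 0, 0, 0] (by simp [Fin.sum_univ_succ, h.sq₂, add_comm])
  · exact key ![0, 0, 0, 0, 0, 1] (by simp [Fin.sum_univ_succ, hb, mul_assoc])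
  · exact key ![0, Q, 0, 0, Q - 1, 0] (by simp [Fin.sum_univ_succ, h₂, add_comm])
  · exact key ![0, 0, 0, Q, 0, Q - 1] (by simp [Fin.sum_univ_succ, mul_assoc, hb', add_comm])

/-- A leading `g₁` is absorbed into `e` as the scalar `Q`, leaving only the coset representatives
`1, g₂, g₂ g₁` on the right. -/
theorem e_mul_heckeBasis_mem (h : QBrauerThreeRel Q b g₁ g₂ e) (i : Fin 6) :
    e * heckeBasis g₁ g₂ i ∈ Submodule.span F (Set.range (idealBasis g₁ g₂ e)) := by
  have key (c : F) (j : Fin 3)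
      (hc : e * heckeBasis g₁ g₂ i = c • (e * (![1, g₂, g₂ * g₁] : Fin 3 → A) j)) :
      e * heckeBasis g₁ g₂ i ∈ Submodule.span F (Set.range (idealBasis g₁ g₂ e)) := by
    rw [hc]
    exact Submodule.smul_mem _ _ (Submodule.subset_span ⟨(0, j), by simp [idealBasis]⟩)
  have h₁ (x : A) : e * (g₁ * x) = Q • (e * x) := by rw [← mul_assoc, h.e_g₁, smul_mul_assoc]
  fin_cases i
  · exact key 1 0 (by simp)
  · exact key Q 0 (by simp [h.e_g₁])
  · exact key 1 1 (by simp)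
  · exact key Q 1 (by simp [h₁])
  · exact key 1 2 (by simp)
  · exact key Q 2 (by simp [h₁, mul_assoc])

theorem span_eq_top (h : QBrauerThreeRel Q b g₁ g₂ e)
    (hs : Algebra.adjoin F {g₁, g₂, e} = ⊤) :
    Submodule.span F (Set.range (heckeBasis g₁ g₂)) ⊔
      Submodule.span F (Set.range (idealBasis g₁ g₂ e)) = ⊤ := by
  refine Submodule.eq_top_of_mul_mem hs _
    (Submodule.mem_sup_left (Submodule.subset_span ⟨0, rfl⟩)) fun g hg x hx => ?_
  obtain ⟨y, hy, z, hz, rfl⟩ := Submodule.mem_sup.1 hx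
  rw [mul_add]
  have hg' : g = g₁ ∨ g = g₂ ∨ g = e := hg
  refine Submodule.add_mem _ ?_ (Submodule.mem_sup_right
    (Submodule.mul_mem_of_forall_mul_mem _ _ g (h.mul_idealBasis_mem hg') hz))
  rcases hg' with hg | hg | rfl
  · exact Submodule.mem_sup_left
      (Submodule.mul_mem_of_forall_mul_mem _ _ g (h.mul_heckeBasis_mem (.inl hg)) hy)
  · exact Submodule.mem_sup_left
      (Submodule.mul_mem_of_forall_mul_mem _ _ g (h.mul_heckeBasis_mem (.inr hg)) hy)
  · exact Submodule.mem_sup_right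
      (Submodule.mul_mem_of_forall_mul_mem _ _ g h.e_mul_heckeBasis_mem hy)

end Spanning

end QBrauerThreeRel

/-! ### Three-strand q-Brauer algebra: representations and semisimplicity -/

namespace QBrauerThreeRel

section Semisimple

variable {F A : Type*} [Field F] [Ring A] [Algebra F A] {Q b : F} {g₁ g₂ e : A}

/-- The Gram matrix of the three-dimensional cell module. -/
abbrev gram (Q b : F) : Matrix (Fin 3) (Fin 3) F :=
  !![-b, b, Q * b; b, -b, Q ^ 2 * b; Q * b, Q ^ 2 * b, (Q ^ 3 - Q ^ 2 - Q) * b]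

theorem isUnit_gram (hQ : Q ≠ 0) (hb : b ≠ 0) (h2 : 1 + Q ≠ 0) : IsUnit (gram Q b) := by
  rw [Matrix.isUnit_iff_isUnit_det, isUnit_iff_ne_zero]
  have : (gram Q b).det = b ^ 3 * Q ^ 2 * (1 + Q) ^ 2 := by
    rw [Matrix.det_fin_three]
    simp only [Matrix.of_apply, Matrix.cons_val]
    ring
  rw [this]
  exact mul_ne_zero (mul_ne_zero (pow_ne_zero _ hb) (pow_ne_zero _ hQ)) (pow_ne_zero _ h2)

/-- The action of `g₁` on the three-dimensional cell module. -/
abbrev cellG₁ (Q : F) : Matrix (Fin 3) (Fin 3) F := !![Q, 0, 0; 0, 0, Q; 0, 1, Q - 1]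

/-- The action of `g₂` on the three-dimensional cell module. -/
abbrev cellG₂ (Q : F) : Matrix (Fin 3) (Fin 3) F := !![0, Q, 0; 1, Q - 1, 0; 0, 0, Q]

/-- The action of `e` on the three-dimensional cell module. -/
abbrev cellE (Q b : F) : Matrix (Fin 3) (Fin 3) F := !![-b, b, Q * b; 0, 0, 0; 0, 0, 0]

/-- The action of `g₁` in the two-dimensional representation of the Hecke algebra. -/
abbrev burauG₁ (Q : F) : Matrix (Fin 2) (Fin 2) F := !![-1, Q; 0, Q]

/-- The action of `g₂` in the two-dimensional representation of the Hecke algebra. -/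
abbrev burauG₂ (Q : F) : Matrix (Fin 2) (Fin 2) F := !![Q, 0; 1, -1]

/-- With `x_k e` as the basis, `e y_j x_k e` is `gram j k` times `e`, so `x_i e y_j` sends the
`k`-th basis vector to `gram j k` times the `i`-th. -/
theorem cell_idealBasis (Q b : F) (p : Fin 3 × Fin 3) :
    idealBasis (cellG₁ Q) (cellG₂ Q) (cellE Q b) p =
      Matrix.single p.1 p.2 1 * gram Q b := by
  obtain ⟨i, j⟩ := p
  have hx : (![1, cellG₂ Q, cellG₁ Q * cellG₂ Q] : Fin 3 → Matrix (Fin 3) (Fin 3) F) i * cellE Q b =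
      Matrix.single i 0 1 * cellE Q b := by
    fin_cases i <;> ext k l <;> fin_cases k <;> fin_cases l <;>
      simp [Matrix.mul_apply, Fin.sum_univ_three, Matrix.single]
  have hy : cellE Q b * (![1, cellG₂ Q, cellG₂ Q * cellG₁ Q] : Fin 3 → Matrix (Fin 3) (Fin 3) F) j =
      Matrix.single 0 j 1 * gram Q b := by
    fin_cases j <;> ext k l <;> fin_cases k <;> fin_cases l <;>
      simp [Matrix.mul_apply, Fin.sum_univ_three, Matrix.single] <;> ring
  rw [idealBasis, hx, mul_assoc, hy, ← mul_assoc, Matrix.single_mul_single_same, mul_one]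

theorem map_idealBasis {B : Type*} [Ring B] [Algebra F B] (f : A →ₐ[F] B) (p : Fin 3 × Fin 3) :
    f (idealBasis g₁ g₂ e p) = idealBasis (f g₁) (f g₂) (f e) p := by
  obtain ⟨i, j⟩ := p
  fin_cases i <;> fin_cases j <;> simp [idealBasis]

theorem map_sum_idealBasis {ρ : A →ₐ[F] Matrix (Fin 3) (Fin 3) F} (h₁ : ρ g₁ = cellG₁ Q)
    (h₂ : ρ g₂ = cellG₂ Q) (he : ρ e = cellE Q b) (c : Fin 3 × Fin 3 → F) :
    ρ (∑ p, c p • idealBasis g₁ g₂ e p) = (Matrix.of fun i j => c (i, j)) * gram Q b := by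
  conv_rhs => rw [Matrix.matrix_eq_sum_single (Matrix.of fun i j => c (i, j))]
  rw [map_sum, Fintype.sum_prod_type]
  simp only [Finset.sum_mul, map_smul, map_idealBasis, h₁, h₂, he, cell_idealBasis,
    ← Matrix.smul_mul, Matrix.smul_single, Matrix.of_apply, smul_eq_mul, mul_one]

theorem cell_surjective (hQ : Q ≠ 0) (hb : b ≠ 0) (h2 : 1 + Q ≠ 0)
    {ρ : A →ₐ[F] Matrix (Fin 3) (Fin 3) F} (h₁ : ρ g₁ = cellG₁ Q)
    (h₂ : ρ g₂ = cellG₂ Q) (he : ρ e = cellE Q b) : Function.Surjective ρ := fun M => by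
  obtain ⟨u, hu⟩ := isUnit_gram hQ hb h2
  refine ⟨∑ p, (fun p : Fin 3 × Fin 3 => (M * (↑u⁻¹ : Matrix (Fin 3) (Fin 3) F)) p.1 p.2) p •
    idealBasis g₁ g₂ e p, ?_⟩
  rw [map_sum_idealBasis h₁ h₂ he, ← hu]
  exact Units.inv_mul_cancel_right M u

theorem burau_surjective (hQ : Q ≠ 0) (h3 : 1 + Q + Q ^ 2 ≠ 0)
    {ρ : A →ₐ[F] Matrix (Fin 2) (Fin 2) F} (h₁ : ρ g₁ = burauG₁ Q) (h₂ : ρ g₂ = burauG₂ Q) :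
    Function.Surjective ρ := fun M => by
  set d := (1 + Q + Q ^ 2)⁻¹ with hd
  have hd1 : (1 + Q + Q ^ 2) * d = 1 := mul_inv_cancel₀ h3
  have hQ1 : Q * Q⁻¹ = 1 := mul_inv_cancel₀ hQ
  -- Each `g_i + 1` acts with a single nonzero column. The first two elements span the matrices
  -- supported in the first column, the last two those supported in the second. The coefficients
  -- come from Cramer's rule, with determinants `1 + Q + Q ^ 2` and `-Q * (1 + Q + Q ^ 2)`.
  refine ⟨(d * ((1 + Q) * M 0 0 - Q * M 1 0)) • (g₂ + 1) +
    (d * ((1 + Q) * M 1 0 - M 0 0)) • ((g₁ + 1) * (g₂ + 1)) +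
    (d * ((1 + Q) * M 1 1 - M 0 1)) • (g₁ + 1) +
    (d * ((1 + Q) * Q⁻¹ * M 0 1 - M 1 1)) • ((g₂ + 1) * (g₁ + 1)), ?_⟩
  simp only [map_add, map_smul, map_mul, map_one, h₁, h₂]
  ext i j
  fin_cases i <;> fin_cases j <;> simp [Matrix.mul_apply, Fin.sum_univ_two]
  · linear_combination M 0 0 * hd1
  · linear_combination M 0 1 * hd1 + d * (1 + Q) ^ 2 * M 0 1 * hQ1
  · linear_combination M 1 0 * hd1
  · linear_combination M 1 1 * hd1 + d * (1 + Q) * M 0 1 * hQ1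

theorem heckeBasis_linearIndependent (h2 : 1 + Q ≠ 0) (h3 : 1 + Q + Q ^ 2 ≠ 0)
    (hQ : Q ≠ 0) {χ ψ : A →ₐ[F] F} {ρ : A →ₐ[F] Matrix (Fin 2) (Fin 2) F}
    (hχ₁ : χ g₁ = Q) (hχ₂ : χ g₂ = Q) (hψ₁ : ψ g₁ = -1) (hψ₂ : ψ g₂ = -1)
    (hρ₁ : ρ g₁ = burauG₁ Q) (hρ₂ : ρ g₂ = burauG₂ Q) (c : Fin 6 → F)
    (hχ : χ (∑ k, c k • heckeBasis g₁ g₂ k) = 0) (hψ : ψ (∑ k, c k • heckeBasis g₁ g₂ k) = 0)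
    (hρ : ρ (∑ k, c k • heckeBasis g₁ g₂ k) = 0) : c = 0 := by
  have hρ' := fun i j => congrFun (congrFun hρ i) j
  have h11 := hρ' 0 0
  have h12 := hρ' 0 1
  have h21 := hρ' 1 0
  have h22 := hρ' 1 1
  simp [Fin.sum_univ_succ, hχ₁, hχ₂, hψ₁, hψ₂, hρ₁, hρ₂] at hχ hψ h11 h12 h21 h22
  -- The two-dimensional representation leaves `c 4` and `c 5` free, and the sign character then
  -- makes all six coefficients equal. The trivial character evaluates the sum of the basis to the
  -- Poincaré polynomial `(1 + Q) * (1 + Q + Q ^ 2)`, which is nonzero.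
  have e3 : c 3 = c 1 + Q * c 4 - Q * c 5 := mul_left_cancel₀ hQ (by linear_combination -h12)
  have e2 : c 2 = c 4 + Q * c 5 - Q * c 3 := by linear_combination h21
  have k1 : c 1 = (1 - Q) * c 4 + Q * c 5 := mul_left_cancel₀ h3
    (by linear_combination h22 - h11 + (1 + Q) * e2 - Q ^ 2 * e3)
  have k3 : c 3 = c 4 := by linear_combination e3 + k1
  have k2 : c 2 = (1 - Q) * c 4 + Q * c 5 := by linear_combination e2 - Q * k3
  have k0 : c 0 = (1 - Q + Q ^ 2) * c 4 + (Q - Q ^ 2) * c 5 := by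
    linear_combination h11 + k1 - Q * k2
  have k4 : c 4 = c 5 := mul_left_cancel₀ h3 (by linear_combination hψ - k0 + k1 + k2 - k3)
  have k5 : c 5 = 0 := mul_left_cancel₀ (mul_ne_zero h2 h3) (by
    linear_combination hχ - (k0 + (1 - Q + Q ^ 2) * k4) - Q * (k1 + (1 - Q) * k4) -
      Q * (k2 + (1 - Q) * k4) - Q ^ 2 * (k3 + k4) - Q ^ 2 * k4)
  rw [k5] at k4
  rw [k4, k5] at k0 k1 k2
  rw [k4] at k3
  ext i
  fin_cases i <;> simp [k0, k1, k2, k3, k4, k5]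

/-- The `q`-Brauer algebra on three strands with `a = -b`, `c = b` is semisimple if `Q`, `b`,
`1 + Q` and `1 + Q + Q ^ 2` do not vanish. -/
theorem isSemisimpleRing (h : QBrauerThreeRel Q b g₁ g₂ e)
    (hs : Algebra.adjoin F {g₁, g₂, e} = ⊤) (hQ : Q ≠ 0) (hb : b ≠ 0) (h2 : 1 + Q ≠ 0)
    (h3 : 1 + Q + Q ^ 2 ≠ 0) {χ ψ : A →ₐ[F] F} {ρ : A →ₐ[F] Matrix (Fin 2) (Fin 2) F}
    {σ : A →ₐ[F] Matrix (Fin 3) (Fin 3) F}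
    (hχ₁ : χ g₁ = Q) (hχ₂ : χ g₂ = Q) (hχe : χ e = 0)
    (hψ₁ : ψ g₁ = -1) (hψ₂ : ψ g₂ = -1) (hψe : ψ e = 0)
    (hρ₁ : ρ g₁ = burauG₁ Q) (hρ₂ : ρ g₂ = burauG₂ Q) (hρe : ρ e = 0)
    (hσ₁ : σ g₁ = cellG₁ Q) (hσ₂ : σ g₂ = cellG₂ Q) (hσe : σ e = cellE Q b) :
    IsSemisimpleRing A := by
  have htop := h.span_eq_top hs
  have : Module.Finite F A := ⟨by
    rw [← htop]
    exact (Submodule.fg_span (Set.finite_range _)).sup (Submodule.fg_span (Set.finite_range _))⟩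
  refine isSemisimpleRing_of_jacobson_eq_zero F fun x hx => ?_
  have hx' : x ∈ Submodule.span F (Set.range (heckeBasis g₁ g₂)) ⊔
      Submodule.span F (Set.range (idealBasis g₁ g₂ e)) := htop ▸ Submodule.mem_top
  obtain ⟨y, hy, z, hz, rfl⟩ := Submodule.mem_sup.1 hx'
  obtain ⟨c, rfl⟩ := (Submodule.mem_span_range_iff_exists_fun F).1 hy
  obtain ⟨d, rfl⟩ := (Submodule.mem_span_range_iff_exists_fun F).1 hz
  -- The Hecke representations kill `e`, so they see only the first summand. Once that vanishes, the
  -- cell module detects the second.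
  have hd {B : Type _} [Ring B] [Algebra F B] (f : A →ₐ[F] B) (hf : f e = 0) :
      f (∑ p, d p • idealBasis g₁ g₂ e p) = 0 := by
    simp [map_sum, hf, idealBasis]
  have hχ : χ _ = 0 := map_eq_zero_of_mem_jacobson χ.toRingHom χ.surjective_to_field hx
  have hψ : ψ _ = 0 := map_eq_zero_of_mem_jacobson ψ.toRingHom ψ.surjective_to_field hx
  have hρ : ρ _ = 0 :=
    map_eq_zero_of_mem_jacobson ρ.toRingHom (burau_surjective hQ h3 hρ₁ hρ₂) hx
  have hσ : σ _ = 0 :=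
    map_eq_zero_of_mem_jacobson σ.toRingHom (cell_surjective hQ hb h2 hσ₁ hσ₂ hσe) hx
  rw [map_add, hd _ hχe, add_zero] at hχ
  rw [map_add, hd _ hψe, add_zero] at hψ
  rw [map_add, hd _ hρe, add_zero] at hρ
  have hc := heckeBasis_linearIndependent h2 h3 hQ hχ₁ hχ₂ hψ₁ hψ₂ hρ₁ hρ₂ c hχ hψ hρ
  rw [hc] at hσ ⊢
  simp only [Pi.zero_apply, zero_smul, Finset.sum_const_zero, zero_add] at hσ ⊢
  rw [map_sum_idealBasis hσ₁ hσ₂ hσe, (isUnit_gram hQ hb h2).mul_left_eq_zero] at hσ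
  refine Finset.sum_eq_zero fun p _ => ?_
  have hp : d p = 0 := congrFun (congrFun hσ p.1) p.2
  rw [hp, zero_smul]

end Semisimple

end QBrauerThreeRel

/-! ### From the presentation to the three-strand relations -/

namespace QBrauerRel

variable {F : Type*} [Field F] {n : ℕ} {Q a b c : F}

/-- The image of a generator in the `q`-Brauer algebra. -/
abbrev gen (n : ℕ) (Q a b c : F) (x : QBrauerGen n) : RingQuot (QBrauerRel n Q a b c) :=
  RingQuot.mkAlgHom F _ (FreeAlgebra.ι F x)

theorem exists_algHom {B : Type*} [Ring B] [Algebra F B] (f : QBrauerGen n → B)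
    (h : ∀ x y, QBrauerRel n Q a b c x y → FreeAlgebra.lift F f x = FreeAlgebra.lift F f y) :
    ∃ φ : RingQuot (QBrauerRel n Q a b c) →ₐ[F] B, ∀ x, φ (gen n Q a b c x) = f x :=
  ⟨RingQuot.liftAlgHom F ⟨FreeAlgebra.lift F f, h⟩, fun x => by
    rw [gen, RingQuot.liftAlgHom_mkAlgHom_apply, FreeAlgebra.lift_ι_apply]⟩

theorem gen_g_mul_self (i : Fin (n - 1)) :
    gen n Q a b c (.g i) * gen n Q a b c (.g i) = (Q - 1) • gen n Q a b c (.g i) + Q • 1 := by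
  simpa using RingQuot.mkAlgHom_rel F (QBrauerRel.hecke_quadratic (Q := Q) (a := a) (b := b)
    (c := c) i)

/-- The quadratic relation makes the inverse a polynomial in the generator, so formal inverses can
be dropped from generating sets. -/
theorem gen_gInv (hQ : Q ≠ 0) (i : Fin (n - 1)) :
    gen n Q a b c (.gInv i) = Q⁻¹ • (gen n Q a b c (.g i) - (Q - 1) • 1) := by
  have h1 : gen n Q a b c (.g i) * gen n Q a b c (.gInv i) = 1 := by
    simpa using RingQuot.mkAlgHom_rel F (QBrauerRel.g_gInv (Q := Q) (a := a) (b := b) (c := c) i)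
  have h2 := congrArg (· * gen n Q a b c (.gInv i)) (gen_g_mul_self (Q := Q) (a := a) (b := b)
    (c := c) i)
  simp only [mul_assoc, h1, mul_one, add_mul, smul_mul_assoc, one_mul] at h2
  rw [h2, add_sub_cancel_left, smul_smul, inv_mul_cancel₀ hQ, one_smul]

/-- For `Q ≠ 0` the `q`-Brauer algebra is generated by the `g_i` and `e`. -/
theorem adjoin_eq_top (hQ : Q ≠ 0) {s : Set (RingQuot (QBrauerRel n Q a b c))}
    (hg : ∀ i, gen n Q a b c (.g i) ∈ s) (he : gen n Q a b c .e ∈ s) :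
    Algebra.adjoin F s = ⊤ := by
  rw [eq_top_iff, ← adjoin_range_mkAlgHom_ι, Algebra.adjoin_le_iff]
  rintro _ ⟨i | i | _, rfl⟩
  · exact Algebra.subset_adjoin (hg i)
  · change gen n Q a b c (.gInv i) ∈ Algebra.adjoin F s
    rw [gen_gInv hQ]
    exact Subalgebra.smul_mem _ (Subalgebra.sub_mem _ (Algebra.subset_adjoin (hg i))
      (Subalgebra.smul_mem _ (Subalgebra.one_mem _) _)) _
  · exact Algebra.subset_adjoin he

theorem quadratic_inverse {B : Type*} [Ring B] [Algebra F B] (hQ : Q ≠ 0) {g : B}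
    (h : g * g = (Q - 1) • g + Q • 1) :
    g * (Q⁻¹ • (g - (Q - 1) • 1)) = 1 ∧ (Q⁻¹ • (g - (Q - 1) • 1)) * g = 1 := by
  simp [mul_sub, sub_mul, h, smul_smul, inv_mul_cancel₀ hQ]

/-- Seven relations suffice: those needing a third index are vacuous, and for `a = -b` the relation
for `e g₂⁻¹ e` follows from those for `e²` and `e g₂ e`. -/
theorem exists_algHom_three {B : Type*} [Ring B] [Algebra F B] (hQ : Q ≠ 0) {g₁ g₂ e : B}
    (h : QBrauerThreeRel Q b g₁ g₂ e) :
    ∃ φ : RingQuot (QBrauerRel 3 Q (-b) b b) →ₐ[F] B, φ (gen 3 Q (-b) b b (.g (0 : Fin 2))) = g₁ ∧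
      φ (gen 3 Q (-b) b b (.g (1 : Fin 2))) = g₂ ∧ φ (gen 3 Q (-b) b b .e) = e := by
  let t : Fin 2 → B := ![g₁, g₂]
  have hsq (i : Fin 2) : t i * t i = (Q - 1) • t i + Q • 1 := by
    fin_cases i
    exacts [h.sq₁, h.sq₂]
  obtain ⟨φ, hφ⟩ := exists_algHom (n := 3) (Q := Q) (a := -b) (b := b) (c := b)
    (fun | .g i => t i | .gInv i => Q⁻¹ • (t i - (Q - 1) • 1) | .e => e) (fun x y hxy => by
      cases hxy with
      | g_gInv i => simpa using (quadratic_inverse hQ (hsq i)).1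
      | gInv_g i => simpa using (quadratic_inverse hQ (hsq i)).2
      | hecke_quadratic i => simpa using hsq i
      | hecke_braid i j hij =>
        obtain rfl : i = (0 : Fin 2) := Fin.ext (by have := j.2; simp; omega)
        obtain rfl : j = (1 : Fin 2) := Fin.ext hij
        simpa [t] using h.braid
      | hecke_comm i j hij => exact absurd j.2 (by omega)
      | e_sq => simpa using h.e_sq
      | e_comm i hi => exact absurd i.2 (by omega)
      | e_g_one i hi =>
        obtain rfl : i = (0 : Fin 2) := Fin.ext hi
        simpa [t] using h.e_g₁
      | g_one_e i hi =>
        obtain rfl : i = (0 : Fin 2) := Fin.ext hi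
        simpa [t] using h.g₁_e
      | e_g_two_e i hi =>
        obtain rfl : i = (1 : Fin 2) := Fin.ext hi
        simpa [t] using h.e_g₂_e
      | e_gInv_two_e i hi =>
        obtain rfl : i = (1 : Fin 2) := Fin.ext hi
        have : Q⁻¹ * (b + (Q - 1) * b) = b := by field_simp; ring
        simp only [map_mul, FreeAlgebra.lift_ι_apply, map_smul]
        simp only [t, Matrix.cons_val_one, Matrix.cons_val_fin_one, mul_smul_comm,
          smul_mul_assoc, mul_sub, sub_mul, mul_one, h.e_g₂_e, h.e_sq, smul_smul, smul_sub,
          ← sub_smul]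
        congr 1
        linear_combination this
      | e_two i j k hi hj hk => exact absurd k.2 (by omega))
  exact ⟨φ, hφ _, hφ _, hφ _⟩

theorem gen_three : QBrauerThreeRel Q b (gen 3 Q (-b) b b (.g (0 : Fin 2)))
    (gen 3 Q (-b) b b (.g (1 : Fin 2))) (gen 3 Q (-b) b b .e) where
  sq₁ := gen_g_mul_self _
  sq₂ := gen_g_mul_self _
  braid := by simpa using RingQuot.mkAlgHom_rel F (QBrauerRel.hecke_braid (n := 3) (Q := Q)
    (a := -b) (b := b) (c := b) (0 : Fin 2) (1 : Fin 2) rfl)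
  e_sq := by simpa only [map_mul, map_smul] using RingQuot.mkAlgHom_rel F (QBrauerRel.e_sq (n := 3) (Q := Q)
    (a := -b) (b := b) (c := b))
  e_g₁ := by simpa using RingQuot.mkAlgHom_rel F (QBrauerRel.e_g_one (n := 3) (Q := Q)
    (a := -b) (b := b) (c := b) (0 : Fin 2) rfl)
  g₁_e := by simpa using RingQuot.mkAlgHom_rel F (QBrauerRel.g_one_e (n := 3) (Q := Q)
    (a := -b) (b := b) (c := b) (0 : Fin 2) rfl)
  e_g₂_e := by simpa using RingQuot.mkAlgHom_rel F (QBrauerRel.e_g_two_e (n := 3) (Q := Q)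
    (a := -b) (b := b) (c := b) (1 : Fin 2) rfl)

/-- The `q`-Brauer algebra on three strands with `a = -b`, `c = b` is semisimple if `Q`, `b`,
`1 + Q` and `1 + Q + Q ^ 2` do not vanish. -/
theorem isSemisimpleRing_three (hQ : Q ≠ 0) (hb : b ≠ 0) (h2 : 1 + Q ≠ 0)
    (h3 : 1 + Q + Q ^ 2 ≠ 0) : IsSemisimpleRing (RingQuot (QBrauerRel 3 Q (-b) b b)) := by
  have rχ : QBrauerThreeRel Q b Q Q (0 : F) := by constructor <;> simp <;> ring
  have rψ : QBrauerThreeRel Q b (-1) (-1) (0 : F) := by constructor <;> simp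
  have rρ : QBrauerThreeRel Q b (QBrauerThreeRel.burauG₁ Q) (QBrauerThreeRel.burauG₂ Q) 0 := by
    constructor <;> ext i j <;> fin_cases i <;> fin_cases j <;> simp <;> ring
  have rσ : QBrauerThreeRel Q b (QBrauerThreeRel.cellG₁ Q) (QBrauerThreeRel.cellG₂ Q)
      (QBrauerThreeRel.cellE Q b) := by
    constructor <;> ext i j <;> fin_cases i <;> fin_cases j <;> simp <;> ring
  obtain ⟨χ, hχ₁, hχ₂, hχe⟩ := exists_algHom_three hQ rχ
  obtain ⟨ψ, hψ₁, hψ₂, hψe⟩ := exists_algHom_three hQ rψ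
  obtain ⟨ρ, hρ₁, hρ₂, hρe⟩ := exists_algHom_three hQ rρ
  obtain ⟨σ, hσ₁, hσ₂, hσe⟩ := exists_algHom_three hQ rσ
  refine gen_three.isSemisimpleRing (adjoin_eq_top hQ (fun i => ?_) (by simp)) hQ hb h2 h3
    hχ₁ hχ₂ hχe hψ₁ hψ₂ hψe hρ₁ hρ₂ hρe hσ₁ hσ₂ hσe
  change Fin 2 at i
  fin_cases i <;> simp

end QBrauerRel

/-! ### Three-strand BMW algebra at `r = q⁻¹` -/

namespace BMWRel

variable {F : Type*} [Field F] {n : ℕ} {r q : F}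

/-- The image of a generator in the Birman–Murakami–Wenzl algebra. -/
abbrev gen (n : ℕ) (r q : F) (x : BMWGen n) : BMW n r q :=
  RingQuot.mkAlgHom F _ (FreeAlgebra.ι F x)

theorem exists_algHom {B : Type*} [Ring B] [Algebra F B] (f : BMWGen n → B)
    (h : ∀ x y, BMWRel n r q x y → FreeAlgebra.lift F f x = FreeAlgebra.lift F f y) :
    ∃ φ : BMW n r q →ₐ[F] B, ∀ x, φ (gen n r q x) = f x :=
  ⟨RingQuot.liftAlgHom F ⟨FreeAlgebra.lift F f, h⟩, fun x => by
    rw [gen, RingQuot.liftAlgHom_mkAlgHom_apply, FreeAlgebra.lift_ι_apply]⟩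

/-- The action of `T₁` on the three-dimensional cell module with `r = q⁻¹`. -/
abbrev cellT₁ (q : F) : Matrix (Fin 3) (Fin 3) F :=
  !![q, 0, -(q - q⁻¹); 0, 0, 1; 0, 1, q - q⁻¹]

/-- The action of `T₁⁻¹` on the three-dimensional cell module with `r = q⁻¹`. -/
abbrev cellTInv₁ (q : F) : Matrix (Fin 3) (Fin 3) F :=
  !![q⁻¹, (q - q⁻¹) * q⁻¹, 0; 0, -(q - q⁻¹), 1; 0, 1, 0]

/-- The action of `T₂` on the three-dimensional cell module with `r = q⁻¹`. -/
abbrev cellT₂ (q : F) : Matrix (Fin 3) (Fin 3) F :=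
  !![0, 1, 0; 1, q - q⁻¹, 0; 0, -(q - q⁻¹) * q, q]

/-- The action of `T₂⁻¹` on the three-dimensional cell module with `r = q⁻¹`. -/
abbrev cellTInv₂ (q : F) : Matrix (Fin 3) (Fin 3) F :=
  !![-(q - q⁻¹), 1, 0; 1, 0, 0; q - q⁻¹, 0, q⁻¹]

/-- The action of `(q - q⁻¹) E₁` on the three-dimensional cell module with `r = q⁻¹`. -/
abbrev cellE₁ (q : F) : Matrix (Fin 3) (Fin 3) F :=
  !![0, (q - q⁻¹) * q⁻¹, q - q⁻¹; 0, 0, 0; 0, 0, 0]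

/-- The action of `(q - q⁻¹) E₂` on the three-dimensional cell module with `r = q⁻¹`. -/
abbrev cellE₂ (q : F) : Matrix (Fin 3) (Fin 3) F :=
  !![0, 0, 0; 0, 0, 0; q - q⁻¹, (q - q⁻¹) * q, 0]

theorem cell_wE₁ (q : F) : (q - q⁻¹) • 1 - (cellT₁ q - cellTInv₁ q) = cellE₁ q := by
  ext i j; fin_cases i <;> fin_cases j <;> simp

theorem cell_wE₂ (q : F) : (q - q⁻¹) • 1 - (cellT₂ q - cellTInv₂ q) = cellE₂ q := by
  ext i j; fin_cases i <;> fin_cases j <;> simp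
  ring

/-- The three-dimensional cell module of `𝓑₃(q⁻¹, q)`. -/
theorem exists_cell (hq : q ≠ 0) : ∃ ρ : BMW 3 q⁻¹ q →ₐ[F] Matrix (Fin 3) (Fin 3) F,
    ρ (gen 3 q⁻¹ q (.t (0 : Fin 2))) = cellT₁ q ∧ ρ (gen 3 q⁻¹ q (.t (1 : Fin 2))) = cellT₂ q ∧
    ρ (gen 3 q⁻¹ q (.tInv (0 : Fin 2))) = cellTInv₁ q ∧
    ρ (gen 3 q⁻¹ q (.tInv (1 : Fin 2))) = cellTInv₂ q := by
  let t : Fin 2 → Matrix (Fin 3) (Fin 3) F := ![cellT₁ q, cellT₂ q]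
  let s : Fin 2 → Matrix (Fin 3) (Fin 3) F := ![cellTInv₁ q, cellTInv₂ q]
  let w : Fin 2 → Matrix (Fin 3) (Fin 3) F := ![cellE₁ q, cellE₂ q]
  let f : BMWGen 3 → Matrix (Fin 3) (Fin 3) F := fun
    | .t i => t i
    | .tInv i => s i
  have hw (i : Fin 2) : FreeAlgebra.lift F f (BMWGen.wE q i) = w i := by
    fin_cases i
    · simpa [f, t, s, w] using cell_wE₁ q
    · simpa [f, t, s, w] using cell_wE₂ q
  have hts (i : Fin 2) : t i * s i = 1 := by
    fin_cases i <;> ext i j <;> fin_cases i <;> fin_cases j <;> simp [t, s, hq] <;>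
      field_simp <;> ring
  have hst (i : Fin 2) : s i * t i = 1 := by
    fin_cases i <;> ext i j <;> fin_cases i <;> fin_cases j <;> simp [t, s, hq] <;>
      field_simp <;> ring
  have hbraid : t 0 * t 1 * t 0 = t 1 * t 0 * t 1 := by
    ext i j; fin_cases i <;> fin_cases j <;> simp [t, Matrix.mul_apply, Fin.sum_univ_three] <;>
      field_simp <;> ring
  have huntwist (i : Fin 2) : w i * t i = q⁻¹⁻¹ • w i := by
    fin_cases i <;> ext i j <;> fin_cases i <;> fin_cases j <;> simp [t, w] <;>
      field_simp <;> ring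
  have htangle (i j : Fin 2) (hij : i ≠ j) : w i * t j * w i = (q⁻¹ * (q - q⁻¹)) • w i := by
    fin_cases i <;> fin_cases j <;> first | exact absurd rfl hij | skip
    all_goals
      ext i j; fin_cases i <;> fin_cases j <;>
        -- The cancellation lemmas would turn these entrywise identities into disjunctions.
        simp [t, w, Matrix.mul_apply, Fin.sum_univ_three, -mul_eq_mul_left_iff,
          -mul_eq_mul_right_iff] <;> field_simp <;> ring
  have htangle_inv (i j : Fin 2) (hij : i ≠ j) :
      w i * s j * w i = (q⁻¹⁻¹ * (q - q⁻¹)) • w i := by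
    fin_cases i <;> fin_cases j <;> first | exact absurd rfl hij | skip
    all_goals
      ext i j; fin_cases i <;> fin_cases j <;>
        simp [s, w, Matrix.mul_apply, Fin.sum_univ_three, -mul_eq_mul_left_iff,
          -mul_eq_mul_right_iff] <;> field_simp <;> ring
  obtain ⟨ρ, hρ⟩ := exists_algHom (n := 3) (r := q⁻¹) (q := q) f (fun x y hxy => by
    cases hxy with
    | t_tInv i => simpa [f] using hts i
    | tInv_t i => simpa [f] using hst i
    | braid i j hij =>
      obtain rfl : i = (0 : Fin 2) := Fin.ext (by have := j.2; simp; omega)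
      obtain rfl : j = (1 : Fin 2) := Fin.ext hij
      simpa [f] using hbraid
    | comm i j hij => exact absurd j.2 (by omega)
    | untwist i =>
      rw [map_mul, map_smul, hw, FreeAlgebra.lift_ι_apply]
      exact huntwist i
    | tangle i j hij =>
      rw [map_mul, map_mul, map_smul, hw, FreeAlgebra.lift_ι_apply]
      exact htangle i j (by rintro rfl; omega)
    | tangle_inv i j hij =>
      rw [map_mul, map_mul, map_smul, hw, FreeAlgebra.lift_ι_apply]
      exact htangle_inv i j (by rintro rfl; omega))
  exact ⟨ρ, hρ _, hρ _, hρ _, hρ _⟩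

/-- A common eigenvector of the cell module of `𝓑₃(q⁻¹, q)` for `q ^ 4 = -1`. -/
abbrev cellVec (q : F) : Fin 3 → F := ![-q, 1, -q⁻¹]

/-- A line that is stable under algebra generators is stable under the algebra. -/
theorem exists_smul_of_adjoin_eq_top {A m : Type*} [Ring A] [Algebra F A] [Fintype m]
    [DecidableEq m] {s : Set A} (hs : Algebra.adjoin F s = ⊤) (ρ : A →ₐ[F] Matrix m m F)
    (w : m → F) (h : ∀ g ∈ s, ∃ c : F, (ρ g).mulVec w = c • w) (y : A) :
    ∃ c : F, (ρ y).mulVec w = c • w := by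
  have hy : y ∈ Algebra.adjoin F s := hs ▸ Algebra.mem_top
  induction hy using Algebra.adjoin_induction with
  | mem g hg => exact h g hg
  | algebraMap c => exact ⟨c, by rw [AlgHom.commutes, Algebra.algebraMap_eq_smul_one,
      Matrix.smul_mulVec, Matrix.one_mulVec]⟩
  | add a b _ _ ha hb =>
    obtain ⟨c, hc⟩ := ha
    obtain ⟨d, hd⟩ := hb
    exact ⟨c + d, by rw [map_add, Matrix.add_mulVec, hc, hd, add_smul]⟩
  | mul a b _ _ ha hb =>
    obtain ⟨c, hc⟩ := ha
    obtain ⟨d, hd⟩ := hb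
    exact ⟨d * c, by rw [map_mul, ← Matrix.mulVec_mulVec, hd, Matrix.mulVec_smul, hc, smul_smul]⟩

/-- The algebra `𝓑₃(q⁻¹, q)` is not semisimple if `q ^ 4 = -1`. -/
theorem not_isSemisimpleRing_three (hq : q ^ 4 = -1) (hz : q - q⁻¹ ≠ 0) :
    ¬ IsSemisimpleRing (BMW 3 q⁻¹ q) := by
  have hq0 : q ≠ 0 := by rintro rfl; simp at hz
  obtain ⟨ρ, h₁, h₂, hi₁, hi₂⟩ := exists_cell hq0
  have hinv : q⁻¹ = -q ^ 3 := by
    field_simp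
    linear_combination hq
  have hstab (y) : ∃ c : F, (ρ y).mulVec (cellVec q) = c • cellVec q := by
    refine exists_smul_of_adjoin_eq_top (adjoin_range_mkAlgHom_ι _) ρ _ ?_ y
    rintro _ ⟨i | i, rfl⟩ <;> change Fin 2 at i
    · refine ⟨-q⁻¹, ?_⟩
      change (ρ (gen 3 q⁻¹ q (.t i))).mulVec _ = _
      fin_cases i
      · change (ρ (gen 3 q⁻¹ q (.t (0 : Fin 2)))).mulVec _ = _
        rw [h₁]
        ext k; fin_cases k <;> simp [Matrix.mulVec, dotProduct, Fin.sum_univ_three, hinv]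
        · linear_combination -q ^ 2 * hq
        · linear_combination hq
      · change (ρ (gen 3 q⁻¹ q (.t (1 : Fin 2)))).mulVec _ = _
        rw [h₂]
        ext k; fin_cases k <;> simp [Matrix.mulVec, dotProduct, Fin.sum_univ_three, hinv]
        · linear_combination hq
        · linear_combination -q ^ 2 * hq
    · refine ⟨-q, ?_⟩
      change (ρ (gen 3 q⁻¹ q (.tInv i))).mulVec _ = _
      fin_cases i
      · change (ρ (gen 3 q⁻¹ q (.tInv (0 : Fin 2)))).mulVec _ = _
        rw [hi₁]
        ext k; fin_cases k <;> simp [Matrix.mulVec, dotProduct, Fin.sum_univ_three, hinv]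
        · linear_combination -q ^ 2 * hq
        · linear_combination hq
      · change (ρ (gen 3 q⁻¹ q (.tInv (1 : Fin 2)))).mulVec _ = _
        rw [hi₂]
        ext k; fin_cases k <;> simp [Matrix.mulVec, dotProduct, Fin.sum_univ_three, hinv]
        · linear_combination hq
        · linear_combination -q ^ 2 * hq
  let T₁ := gen 3 q⁻¹ q (.t (0 : Fin 2))
  let T₂ := gen 3 q⁻¹ q (.t (1 : Fin 2))
  let S₁ := gen 3 q⁻¹ q (.tInv (0 : Fin 2))
  -- The right factor has image the first coordinate line. `T₂` moves the first basis vector to the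
  -- second and `T₁` moves that to the third, so the left factor sends the first basis vector to
  -- `cellVec q`.
  have hx : ρ ((-q • 1 + T₂ - q⁻¹ • (T₁ * T₂)) * ((q - q⁻¹) • 1 - (T₁ - S₁))) =
      Matrix.vecMulVec (cellVec q) ![0, (q - q⁻¹) * q⁻¹, q - q⁻¹] := by
    simp only [map_mul, map_add, map_sub, map_smul, map_one, T₁, T₂, S₁, h₁, h₂, hi₁, cell_wE₁]
    ext i j
    fin_cases i <;> fin_cases j <;>
      simp [Matrix.mul_apply, Fin.sum_univ_three, Matrix.vecMulVec]
  refine not_isSemisimpleRing_of_forall_mul_mul_eq_zero (ρ : _ →+* Matrix (Fin 3) (Fin 3) F)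
    ((-q • 1 + T₂ - q⁻¹ • (T₁ * T₂)) * ((q - q⁻¹) • 1 - (T₁ - S₁))) ?_ fun y => ?_
  · intro h0
    have h12 := congrFun (congrFun (hx.symm.trans h0) 1) 2
    exact hz (by simpa [Matrix.vecMulVec] using h12)
  · obtain ⟨c, hc⟩ := hstab y
    change ρ _ * ρ y * ρ _ = 0
    have hw : dotProduct ![0, (q - q⁻¹) * q⁻¹, q - q⁻¹] (cellVec q) = 0 := by
      simp [dotProduct, Fin.sum_univ_three]
    rw [hx, mul_assoc, Matrix.mul_vecMulVec, hc, Matrix.vecMulVec_mul_vecMulVec,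
      dotProduct_smul, hw]
    simp

end BMWRel

/-! ### Two-strand q-Brauer algebra -/

namespace QBrauerRel

variable {F : Type*} [Field F] {Q a b c : F}

theorem exists_algHom_two {B : Type*} [Ring B] [Algebra F B] (hQ : Q ≠ 0) {g e : B}
    (hg : g * g = (Q - 1) • g + Q • 1) (he : e * e = a • e) (heg : e * g = Q • e)
    (hge : g * e = Q • e) :
    ∃ φ : RingQuot (QBrauerRel 2 Q a b c) →ₐ[F] B,
      φ (gen 2 Q a b c (.g (0 : Fin 1))) = g ∧ φ (gen 2 Q a b c .e) = e := by
  obtain ⟨φ, hφ⟩ := exists_algHom (n := 2) (Q := Q) (a := a) (b := b) (c := c)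
    (fun | .g _ => g | .gInv _ => Q⁻¹ • (g - (Q - 1) • 1) | .e => e) (fun x y hxy => by
      cases hxy with
      | g_gInv i => simpa using (quadratic_inverse hQ hg).1
      | gInv_g i => simpa using (quadratic_inverse hQ hg).2
      | hecke_quadratic i => simpa using hg
      | hecke_braid i j hij => exact absurd j.2 (by omega)
      | hecke_comm i j hij => exact absurd j.2 (by omega)
      | e_sq => simpa using he
      | e_comm i hi => exact absurd i.2 (by omega)
      | e_g_one i hi => simpa using heg
      | g_one_e i hi => simpa using hge
      | e_g_two_e i hi => exact absurd i.2 (by omega)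
      | e_gInv_two_e i hi => exact absurd i.2 (by omega)
      | e_two i j k hi hj hk => exact absurd k.2 (by omega))
  exact ⟨φ, hφ _, hφ _⟩

/-- The `q`-Brauer algebra on two strands is semisimple if `Q ≠ -1`. -/
theorem isSemisimpleRing_two (hQ : Q ≠ 0) (ha : a ≠ 0) (h2 : 1 + Q ≠ 0) :
    IsSemisimpleRing (RingQuot (QBrauerRel 2 Q a b c)) := by
  -- The characters send `(g, e)` to `(Q, a)`, `(Q, 0)` and `(-1, 0)`; they are distinct because `a
  -- ≠ 0` and `Q ≠ -1`, and they separate the span of `1, g, e`.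
  obtain ⟨χ, hχg, hχe⟩ := exists_algHom_two (b := b) (c := c) (g := Q) (e := a) (a := a) hQ
    (by simp; ring) (by simp) (by simp [mul_comm]) (by simp)
  obtain ⟨ψ, hψg, hψe⟩ := exists_algHom_two (b := b) (c := c) (g := Q) (e := (0 : F)) (a := a) hQ
    (by simp; ring) (by simp) (by simp) (by simp)
  obtain ⟨ω, hωg, hωe⟩ := exists_algHom_two (b := b) (c := c) (g := -1) (e := (0 : F)) (a := a) hQ
    (by simp) (by simp) (by simp) (by simp)
  set g := gen 2 Q a b c (.g (0 : Fin 1)) with hg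
  set e := gen 2 Q a b c .e with he
  have hgg : g * g = (Q - 1) • g + Q • 1 := gen_g_mul_self _
  have hee : e * e = a • e := by
    simpa only [map_mul, map_smul] using RingQuot.mkAlgHom_rel F
      (QBrauerRel.e_sq (n := 2) (Q := Q) (a := a) (b := b) (c := c))
  have heg : e * g = Q • e := by
    simpa only [map_mul, map_smul] using RingQuot.mkAlgHom_rel F
      (QBrauerRel.e_g_one (n := 2) (Q := Q) (a := a) (b := b) (c := c) (0 : Fin 1) rfl)
  have hge : g * e = Q • e := by
    simpa only [map_mul, map_smul] using RingQuot.mkAlgHom_rel F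
      (QBrauerRel.g_one_e (n := 2) (Q := Q) (a := a) (b := b) (c := c) (0 : Fin 1) rfl)
  have htop : Submodule.span F (Set.range ![1, g, e]) = ⊤ := by
    refine Submodule.eq_top_of_mul_mem (s := {g, e})
      (adjoin_eq_top hQ (fun i => ?_) (by simp [he])) _ (Submodule.subset_span ⟨0, rfl⟩) ?_
    · obtain rfl : i = (0 : Fin 1) := Subsingleton.elim (α := Fin 1) _ _
      simp [hg]
    · intro x hx y hy
      refine Submodule.mul_mem_of_forall_mul_mem _ _ x (fun i => ?_) hy
      rw [Submodule.mem_span_range_iff_exists_fun]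
      rcases hx with rfl | rfl <;> fin_cases i
      · exact ⟨![0, 1, 0], by simp [Fin.sum_univ_three]⟩
      · exact ⟨![Q, Q - 1, 0], by simp [Fin.sum_univ_three, hgg, add_comm]⟩
      · exact ⟨![0, 0, Q], by simp [Fin.sum_univ_three, hge]⟩
      · exact ⟨![0, 0, 1], by simp [Fin.sum_univ_three]⟩
      · exact ⟨![0, 0, Q], by simp [Fin.sum_univ_three, heg]⟩
      · exact ⟨![0, 0, a], by simp [Fin.sum_univ_three, hee]⟩
  have : Module.Finite F (RingQuot (QBrauerRel 2 Q a b c)) :=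
    ⟨by rw [← htop]; exact Submodule.fg_span (Set.finite_range _)⟩
  refine isSemisimpleRing_of_jacobson_eq_zero F fun x hx => ?_
  obtain ⟨d, rfl⟩ := (Submodule.mem_span_range_iff_exists_fun F).1
    (htop ▸ Submodule.mem_top : x ∈ Submodule.span F (Set.range ![1, g, e]))
  have hχ : χ _ = 0 := map_eq_zero_of_mem_jacobson χ.toRingHom χ.surjective_to_field hx
  have hψ : ψ _ = 0 := map_eq_zero_of_mem_jacobson ψ.toRingHom ψ.surjective_to_field hx
  have hω : ω _ = 0 := map_eq_zero_of_mem_jacobson ω.toRingHom ω.surjective_to_field hx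
  simp only [Fin.sum_univ_three, Matrix.cons_val, map_add, map_smul, map_one, hχg, hχe, hψg, hψe,
    hωg, hωe, smul_eq_mul] at hχ hψ hω
  have d2 : d 2 = 0 := mul_right_cancel₀ ha (by linear_combination hχ - hψ)
  have d1 : d 1 = 0 := mul_right_cancel₀ h2 (by linear_combination hψ - hω)
  have d0 : d 0 = 0 := by linear_combination hω + d1
  simp [Fin.sum_univ_three, d0, d1, d2]

/-- The `q`-Brauer algebra on two strands is not semisimple if `Q = -1`. -/
theorem not_isSemisimpleRing_two : ¬ IsSemisimpleRing (RingQuot (QBrauerRel 2 (-1) a b c)) := by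
  obtain ⟨φ, hφg, -⟩ := exists_algHom_two (Q := -1) (a := a) (b := b) (c := c) (e := 0)
    (g := (-1 + DualNumber.eps : DualNumber F)) (by simp)
    (by
      have h : (-1 + DualNumber.eps : DualNumber F) * (-1 + DualNumber.eps) =
          1 - (DualNumber.eps + DualNumber.eps) + DualNumber.eps * DualNumber.eps := by ring
      rw [h, DualNumber.eps_mul_eps]
      ext <;> simp
      ring)
    (by simp) (by simp) (by simp)
  have h : φ (gen 2 (-1) a b c (.g (0 : Fin 1)) + 1) = DualNumber.eps := by
    rw [map_add, hφg, map_one]; ring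
  refine not_isSemisimpleRing_of_mul_self_eq_zero (φ : _ →+* DualNumber F)
    (gen 2 (-1) a b c (.g (0 : Fin 1)) + 1) (fun h0 => ?_) ?_
  · have := congrArg TrivSqZeroExt.snd (h.symm.trans h0)
    simp at this
  · change φ _ * φ _ = 0
    rw [h, DualNumber.eps_mul_eps]

end QBrauerRel

/-! ### Two-strand BMW algebra -/

namespace BMWRel

variable {F : Type*} [Field F] {r q : F}

theorem exists_algHom_two {B : Type*} [Ring B] [Algebra F B] {T S : B} (hTS : T * S = 1)
    (hST : S * T = 1)
    (h : ((q - q⁻¹) • 1 - (T - S)) * T = r⁻¹ • ((q - q⁻¹) • 1 - (T - S))) :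
    ∃ φ : BMW 2 r q →ₐ[F] B, φ (gen 2 r q (.t (0 : Fin 1))) = T := by
  obtain ⟨φ, hφ⟩ := exists_algHom (n := 2) (r := r) (q := q)
    (fun | .t _ => T | .tInv _ => S) (fun x y hxy => by
      cases hxy with
      | t_tInv i => simpa using hTS
      | tInv_t i => simpa using hST
      | braid i j hij => exact absurd j.2 (by omega)
      | comm i j hij => exact absurd j.2 (by omega)
      | untwist i => simpa using h
      | tangle i j hij => exact absurd hij (by omega)
      | tangle_inv i j hij => exact absurd hij (by omega))
  exact ⟨φ, hφ _⟩

theorem exists_algHom_two_field {l : F} (hl : l ≠ 0)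
    (h : (q - q⁻¹ - (l - l⁻¹)) * (l - r⁻¹) = 0) :
    ∃ φ : BMW 2 r q →ₐ[F] F, φ (gen 2 r q (.t (0 : Fin 1))) = l :=
  exists_algHom_two (mul_inv_cancel₀ hl) (inv_mul_cancel₀ hl) (by
    simp only [smul_eq_mul, mul_one]
    linear_combination h)

/-- `𝓑₂(r, q)` is semisimple if `q`, `-q⁻¹` and `r⁻¹` are distinct. -/
theorem isSemisimpleRing_two (hr : r ≠ 0) (hq : q ≠ 0) (h1 : q ≠ -q⁻¹) (h2 : q ≠ r⁻¹)
    (h3 : -q⁻¹ ≠ r⁻¹) : IsSemisimpleRing (BMW 2 r q) := by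
  obtain ⟨χ, hχ⟩ := exists_algHom_two_field (r := r) (q := q) hq (by simp)
  obtain ⟨ψ, hψ⟩ := exists_algHom_two_field (r := r) (q := q) (l := -q⁻¹) (by simpa using hq)
    (by rw [inv_neg, inv_inv]; ring)
  obtain ⟨ω, hω⟩ := exists_algHom_two_field (r := r) (q := q) (l := r⁻¹) (by simpa using hr)
    (by simp)
  set T := gen 2 r q (.t (0 : Fin 1)) with hT
  set S := gen 2 r q (.tInv (0 : Fin 1)) with hS
  have hST : S * T = 1 := by
    simpa only [map_mul, map_one] using RingQuot.mkAlgHom_rel F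
      (BMWRel.tInv_t (n := 2) (r := r) (q := q) (0 : Fin 1))
  have hTS : T * S = 1 := by
    simpa only [map_mul, map_one] using RingQuot.mkAlgHom_rel F
      (BMWRel.t_tInv (n := 2) (r := r) (q := q) (0 : Fin 1))
  have hU : ((q - q⁻¹) • 1 - (T - S)) * T = r⁻¹ • ((q - q⁻¹) • 1 - (T - S)) := by
    simpa only [map_mul, map_one, map_smul, map_sub] using RingQuot.mkAlgHom_rel F
      (BMWRel.untwist (n := 2) (r := r) (q := q) (0 : Fin 1))
  -- The untwisting relation is solved for the inverse; multiplying by `T` then gives the cubic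
  -- equation.
  have hS' : S = (r - (q - q⁻¹)) • 1 + (1 + r * (q - q⁻¹)) • T - r • (T * T) := by
    have h : (q - q⁻¹) • T - T * T + 1 = r⁻¹ • ((q - q⁻¹) • 1 - (T - S)) := by
      rw [← hU]
      simp only [sub_mul, hST, smul_mul_assoc, one_mul]
      abel
    have h' := congrArg (r • ·) h
    simp only [smul_smul, mul_inv_cancel₀ hr, one_smul] at h'
    calc S = r • ((q - q⁻¹) • T - T * T + 1) - (q - q⁻¹) • 1 + T := by rw [h']; abel
      _ = _ := by module
  have hT3 : T * (T * T) = (-r⁻¹) • 1 + (1 - r⁻¹ * (q - q⁻¹)) • T +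
      (r⁻¹ + (q - q⁻¹)) • (T * T) := by
    have h := congrArg (T * ·) hS'
    simp only [hTS, mul_sub, mul_add, mul_smul_comm, mul_one] at h
    have h' : r • (T * (T * T)) =
        (-1 : F) • 1 + (r - (q - q⁻¹)) • T + (1 + r * (q - q⁻¹)) • (T * T) := by
      rw [eq_sub_iff_add_eq] at h
      calc r • (T * (T * T)) = (1 + r • (T * (T * T))) - 1 := by abel
        _ = _ := by rw [h]; module
    have h'' := congrArg (r⁻¹ • ·) h'
    simp only [smul_add, smul_smul, inv_mul_cancel₀ hr, one_smul] at h''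
    rw [h'']
    congr 3 <;> field_simp
  have htop : Submodule.span F (Set.range ![1, T, T * T]) = ⊤ := by
    refine Submodule.eq_top_of_mul_mem (adjoin_range_mkAlgHom_ι _) _
      (Submodule.subset_span ⟨0, rfl⟩) ?_
    rintro _ ⟨i | i, rfl⟩ y hy <;>
      refine Submodule.mul_mem_of_forall_mul_mem _ _ _ (fun k => ?_) hy <;>
      rw [Submodule.mem_span_range_iff_exists_fun] <;>
      obtain rfl : i = (0 : Fin 1) := Subsingleton.elim (α := Fin 1) _ _
    · change ∃ c : Fin 3 → F, _ = T * _
      fin_cases k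
      · exact ⟨![0, 1, 0], by simp [Fin.sum_univ_three]⟩
      · exact ⟨![0, 0, 1], by simp [Fin.sum_univ_three]⟩
      · exact ⟨![-r⁻¹, 1 - r⁻¹ * (q - q⁻¹), r⁻¹ + (q - q⁻¹)], by
          rw [Fin.sum_univ_three]; exact hT3.symm⟩
    · change ∃ c : Fin 3 → F, _ = S * _
      fin_cases k
      · exact ⟨![r - (q - q⁻¹), 1 + r * (q - q⁻¹), -r], by
          simpa [Fin.sum_univ_three, sub_eq_add_neg] using hS'.symm⟩
      · exact ⟨![1, 0, 0], by simp [Fin.sum_univ_three, hST]⟩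
      · exact ⟨![0, 1, 0], by simp [Fin.sum_univ_three, ← mul_assoc, hST]⟩
  have : Module.Finite F (BMW 2 r q) :=
    ⟨by rw [← htop]; exact Submodule.fg_span (Set.finite_range _)⟩
  refine isSemisimpleRing_of_jacobson_eq_zero F fun x hx => ?_
  obtain ⟨d, rfl⟩ := (Submodule.mem_span_range_iff_exists_fun F).1
    (htop ▸ Submodule.mem_top : x ∈ Submodule.span F (Set.range ![1, T, T * T]))
  have kχ : χ _ = 0 := map_eq_zero_of_mem_jacobson χ.toRingHom χ.surjective_to_field hx
  have kψ : ψ _ = 0 := map_eq_zero_of_mem_jacobson ψ.toRingHom ψ.surjective_to_field hx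
  have kω : ω _ = 0 := map_eq_zero_of_mem_jacobson ω.toRingHom ω.surjective_to_field hx
  simp only [Fin.sum_univ_three, Matrix.cons_val, map_add, map_smul, map_mul, map_one, hχ, hψ, hω,
    smul_eq_mul] at kχ kψ kω
  -- A quadratic polynomial vanishing at three distinct points is zero, by divided differences.
  have e1 : d 1 + d 2 * (q + -q⁻¹) = 0 :=
    mul_left_cancel₀ (sub_ne_zero.2 h1) (by linear_combination kχ - kψ)
  have e2 : d 1 + d 2 * (q + r⁻¹) = 0 :=
    mul_left_cancel₀ (sub_ne_zero.2 h2) (by linear_combination kχ - kω)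
  have d2 : d 2 = 0 := mul_left_cancel₀ (sub_ne_zero.2 h3) (by linear_combination e1 - e2)
  have d1 : d 1 = 0 := by linear_combination e1 - (q + -q⁻¹) * d2
  have d0 : d 0 = 0 := by linear_combination kχ - q * d1 - q * q * d2
  simp [Fin.sum_univ_three, d0, d1, d2]

/-- `𝓑₂(r, q)` is not semisimple if its defining cubic has a double root `l`. -/
theorem not_isSemisimpleRing_two {l : F} (hl : l ≠ 0)
    (h0 : (q - q⁻¹ - (l - l⁻¹)) * (l - r⁻¹) = 0)
    (h1 : q - q⁻¹ - (l - l⁻¹) = (1 + l⁻¹ * l⁻¹) * (l - r⁻¹)) : ¬ IsSemisimpleRing (BMW 2 r q) := by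
  -- Evaluation at `l + ε`: `h0` is the vanishing of the untwisting relation at `l`, and `h1` that
  -- of its derivative.
  obtain ⟨φ, hφ⟩ := exists_algHom_two (r := r) (q := q)
    (T := (TrivSqZeroExt.inl l + DualNumber.eps : DualNumber F))
    (S := TrivSqZeroExt.inl l⁻¹ - (l⁻¹ * l⁻¹) • DualNumber.eps)
    (by ext <;> simp [hl]) (by ext <;> simp [hl])
    (by
      ext
      · simp
        linear_combination h0
      · simp
        linear_combination h1)
  have h : φ (gen 2 r q (.t (0 : Fin 1)) - l • 1) = DualNumber.eps := by
    rw [map_sub, hφ, map_smul, map_one]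
    ext <;> simp
  refine not_isSemisimpleRing_of_mul_self_eq_zero (φ : _ →+* DualNumber F)
    (gen 2 r q (.t (0 : Fin 1)) - l • 1) (fun h0 => ?_) ?_
  · have := congrArg TrivSqZeroExt.snd (h.symm.trans h0)
    simp at this
  · change φ _ * φ _ = 0
    rw [h, DualNumber.eps_mul_eps]

end BMWRel

/-! ### Specialization to the complex parameters -/

theorem Complex.ne_of_sq_eq_neg_I {q : ℂ} (hq : q ^ 2 = -Complex.I) :
    q ≠ 0 ∧ q - q⁻¹ ≠ 0 ∧ q ^ 4 = -1 ∧ q - 1 ≠ 0 := by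
  have h0 : q ≠ 0 := by
    rintro rfl
    simp at hq
  have h4 : q ^ 4 = -1 := by linear_combination (q ^ 2 - Complex.I) * hq + Complex.I_sq
  refine ⟨h0, fun h => ?_, h4, fun h => ?_⟩
  · have h2 : q ^ 2 = 1 := by
      linear_combination q * h + mul_inv_cancel₀ h0
    have : (2 : ℂ) = 0 := by linear_combination h4 - (q ^ 2 + 1) * h2
    norm_num at this
  · rw [sub_eq_zero] at h
    subst h
    norm_num at h4

theorem QBrauerSq.isSemisimpleRing_three {q : ℂ} (hq : q ^ 2 = -Complex.I) :
    IsSemisimpleRing (QBrauerSq 3 q⁻¹ q) := by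
  obtain ⟨h0, hz, h4, h1⟩ := Complex.ne_of_sq_eq_neg_I hq
  have ha : (q⁻¹ - q⁻¹⁻¹) / (q - q⁻¹) = -1 := by
    rw [inv_inv, ← neg_sub, neg_div, div_self hz]
  unfold QBrauerSq
  rw [ha, inv_mul_cancel₀ h0, inv_one]
  refine QBrauerRel.isSemisimpleRing_three (pow_ne_zero 2 h0) one_ne_zero (fun h => ?_)
    (fun h => ?_)
  · have : (2 : ℂ) = 0 := by linear_combination (1 - q ^ 2) * h + h4
    norm_num at this
  · exact pow_ne_zero 2 h0 (by linear_combination h - h4)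

theorem QBrauer.isSemisimpleRing_three {q : ℂ} (hq : q ^ 2 = -Complex.I) :
    IsSemisimpleRing (QBrauer 3 q⁻¹ q) := by
  obtain ⟨h0, hz, h4, h1⟩ := Complex.ne_of_sq_eq_neg_I hq
  have ha : (q⁻¹ - 1) / (q - 1) = -q⁻¹ := by
    rw [div_eq_iff h1]
    field_simp
    ring
  unfold QBrauer
  rw [ha]
  refine QBrauerRel.isSemisimpleRing_three h0 (inv_ne_zero h0) (fun h => ?_) (fun h => ?_)
  · have : (2 : ℂ) = 0 := by linear_combination (1 - q) * (1 + q ^ 2) * h + h4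
    norm_num at this
  · have : q ^ 4 = q := by linear_combination (q ^ 2 - q) * h
    have h' : q = -1 := this.symm.trans h4
    rw [h'] at h4
    norm_num at h4

theorem isEmpty_algEquiv_of_isSemisimpleRing {F A B : Type*} [Field F] [Ring A] [Ring B]
    [Algebra F A] [Algebra F B] (hA : IsSemisimpleRing A) (hB : ¬ IsSemisimpleRing B) :
    IsEmpty (A ≃ₐ[F] B) := ⟨fun f => hB f.toRingEquiv.isSemisimpleRing⟩

theorem BMW.not_isSemisimpleRing_three {q : ℂ} (hq : q ^ 2 = -Complex.I) :
    ¬ IsSemisimpleRing (BMW 3 q⁻¹ q) := by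
  obtain ⟨h0, hz, h4, h1⟩ := Complex.ne_of_sq_eq_neg_I hq
  exact BMWRel.not_isSemisimpleRing_three h4 hz

/-! ### Finite checks over the field with five elements, and the conclusion -/

/-- Replaces inverses by products, so that statements over the finite field can be settled by
`decide`. -/
theorem zmod_five_inv (x : ZMod 5) : x⁻¹ = x * x * x := by
  rcases eq_or_ne x 0 with rfl | hx
  · simp
  · exact inv_eq_of_mul_eq_one_right (by revert x; decide)

/-- The cubic has a double root in two ways. If `q = ±2`, then `q ^ 2 = -1` and `q = -q⁻¹`. If `q =
±1`, the roots `q, -q⁻¹` are `±1`, and `r⁻¹` meets one of them exactly when `r = ±1`. -/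
theorem BMW.not_isSemisimpleRing_two_iff {r q : ZMod 5} (hr : r ≠ 0) (hq : q ≠ 0) :
    ¬ IsSemisimpleRing (BMW 2 r q) ↔ (q = 2 ∨ q = 3) ∨ (r = 1 ∨ r = 4) ∧ (q = 1 ∨ q = 4) := by
  constructor
  · intro h
    by_contra h'
    have key : ∀ r q : ZMod 5, r ≠ 0 → q ≠ 0 →
        ¬ ((q = 2 ∨ q = 3) ∨ (r = 1 ∨ r = 4) ∧ (q = 1 ∨ q = 4)) →
        q ≠ -q⁻¹ ∧ q ≠ r⁻¹ ∧ -q⁻¹ ≠ r⁻¹ := by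
      simp only [zmod_five_inv]
      decide
    obtain ⟨h1, h2, h3⟩ := key r q hr hq h'
    exact h (BMWRel.isSemisimpleRing_two hr hq h1 h2 h3)
  · rintro (h | h)
    · refine BMWRel.not_isSemisimpleRing_two hq (by simp) ?_
      simp only [zmod_five_inv]
      rcases h with rfl | rfl <;> revert r <;> decide
    · refine BMWRel.not_isSemisimpleRing_two hr ?_ ?_ <;> simp only [zmod_five_inv] <;>
        rcases h with ⟨rfl | rfl, rfl | rfl⟩ <;> decide

/-- Admissibility excludes `q = ±1`, which leaves `q ^ 2 = -1`; so every admissible pair is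
degenerate. -/
theorem QBrauerSq.not_isSemisimpleRing_two_iff {r q : ZMod 5} :
    (QBrauerSqParam r q ∧ ¬ IsSemisimpleRing (QBrauerSq 2 r q)) ↔
      (r = 2 ∨ r = 3) ∧ (q = 2 ∨ q = 3) := by
  have key : ∀ r q : ZMod 5, (r ≠ 0 ∧ q ≠ 0 ∧ q - q⁻¹ ≠ 0 ∧ r - r⁻¹ ≠ 0) ↔
      (r = 2 ∨ r = 3) ∧ (q = 2 ∨ q = 3) := by
    simp only [zmod_five_inv]
    decide
  rw [QBrauerSqParam, key, and_iff_left_iff_imp]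
  intro h
  have hq : q ^ 2 = -1 := by rcases h with ⟨-, rfl | rfl⟩ <;> decide
  unfold QBrauerSq
  rw [hq]
  exact QBrauerRel.not_isSemisimpleRing_two

theorem QBrauer.not_isSemisimpleRing_two_iff {r q : ZMod 5} :
    (QBrauerParam r q ∧ ¬ IsSemisimpleRing (QBrauer 2 r q)) ↔
      (r = 2 ∨ r = 3 ∨ r = 4) ∧ q = 4 := by
  have key : ∀ r : ZMod 5, (r = 2 ∨ r = 3 ∨ r = 4) ↔ r ≠ 0 ∧ r - 1 ≠ 0 := by decide
  rw [key]
  constructor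
  · rintro ⟨⟨hr, hq, hq1, hr1⟩, h⟩
    refine ⟨⟨hr, hr1⟩, ?_⟩
    by_contra hq4
    refine h (QBrauerRel.isSemisimpleRing_two hq (div_ne_zero hr1 hq1) ?_)
    clear h hq1
    revert q
    decide
  · rintro ⟨⟨hr, hr1⟩, rfl⟩
    refine ⟨⟨hr, by decide, by decide, hr1⟩, ?_⟩
    -- Here `Q = 4`, which equals `-1` in `ZMod 5` by computation.
    exact QBrauerRel.not_isSemisimpleRing_two

theorem claim1p1 :
    -- The two algebras are in general not isomorphic, for either version of the q-Brauer algebra.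
    (¬ ∀ (n : ℕ) (F : Type) [Field F] (r q : F), 2 ≤ n → QBrauerSqParam r q →
        Nonempty (QBrauerSq n r q ≃ₐ[F] BMW n r q)) ∧
    (¬ ∀ (n : ℕ) (F : Type) [Field F] (r q : F), 2 ≤ n → QBrauerParam r q → q - q⁻¹ ≠ 0 →
        Nonempty (QBrauer n r q ≃ₐ[F] BMW n r q)) ∧
    -- The case n = 3 over ℂ, with q ^ 2 = -i and r = q⁻¹.
    (∀ q : ℂ, q ^ 2 = -Complex.I →
        QBrauerSqParam q⁻¹ q ∧
        IsSemisimpleRing (QBrauerSq 3 q⁻¹ q) ∧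
        ¬ IsSemisimpleRing (BMW 3 q⁻¹ q) ∧
        IsEmpty (QBrauerSq 3 q⁻¹ q ≃ₐ[ℂ] BMW 3 q⁻¹ q)) ∧
    -- The case n = 3 over ℂ, with q = i √i and r = q⁻¹.
    (∀ s q : ℂ, s ^ 2 = Complex.I → q = Complex.I * s →
        QBrauerParam q⁻¹ q ∧ q - q⁻¹ ≠ 0 ∧
        IsSemisimpleRing (QBrauer 3 q⁻¹ q) ∧
        ¬ IsSemisimpleRing (BMW 3 q⁻¹ q) ∧
        IsEmpty (QBrauer 3 q⁻¹ q ≃ₐ[ℂ] BMW 3 q⁻¹ q)) ∧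
    -- The case n = 2 over the field with five elements: all non-semisimple pairs (r, q).
    ({p : ZMod 5 × ZMod 5 | p.1 ≠ 0 ∧ p.2 ≠ 0 ∧ ¬ IsSemisimpleRing (BMW 2 p.1 p.2)} =
        (({1, 2, 3, 4} : Set (ZMod 5)) ×ˢ ({2, 3} : Set (ZMod 5))) ∪
        (({1, 4} : Set (ZMod 5)) ×ˢ ({1, 4} : Set (ZMod 5)))) ∧
    ({p : ZMod 5 × ZMod 5 | QBrauerSqParam p.1 p.2 ∧ ¬ IsSemisimpleRing (QBrauerSq 2 p.1 p.2)} =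
        ({2, 3} : Set (ZMod 5)) ×ˢ ({2, 3} : Set (ZMod 5))) ∧
    ({p : ZMod 5 × ZMod 5 | QBrauerParam p.1 p.2 ∧ ¬ IsSemisimpleRing (QBrauer 2 p.1 p.2)} =
        ({2, 3, 4} : Set (ZMod 5)) ×ˢ ({4} : Set (ZMod 5))) ∧
    -- Their numbers: twelve (eight if q = q⁻¹ is excluded), four and three.
    {p : ZMod 5 × ZMod 5 | p.1 ≠ 0 ∧ p.2 ≠ 0 ∧ ¬ IsSemisimpleRing (BMW 2 p.1 p.2)}.ncard = 12 ∧
    {p : ZMod 5 × ZMod 5 | p.1 ≠ 0 ∧ p.2 ≠ 0 ∧ p.2 - p.2⁻¹ ≠ 0 ∧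
        ¬ IsSemisimpleRing (BMW 2 p.1 p.2)}.ncard = 8 ∧
    {p : ZMod 5 × ZMod 5 |
        QBrauerSqParam p.1 p.2 ∧ ¬ IsSemisimpleRing (QBrauerSq 2 p.1 p.2)}.ncard = 4 ∧
    {p : ZMod 5 × ZMod 5 |
        QBrauerParam p.1 p.2 ∧ ¬ IsSemisimpleRing (QBrauer 2 p.1 p.2)}.ncard = 3 := by
  have hsq : ∀ q : ℂ, q ^ 2 = -Complex.I →
      QBrauerSqParam q⁻¹ q ∧ IsSemisimpleRing (QBrauerSq 3 q⁻¹ q) ∧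
        ¬ IsSemisimpleRing (BMW 3 q⁻¹ q) ∧ IsEmpty (QBrauerSq 3 q⁻¹ q ≃ₐ[ℂ] BMW 3 q⁻¹ q) := by
    intro q hq
    obtain ⟨h0, hz, -, -⟩ := Complex.ne_of_sq_eq_neg_I hq
    have hA := QBrauerSq.isSemisimpleRing_three hq
    have hB := BMW.not_isSemisimpleRing_three hq
    refine ⟨⟨inv_ne_zero h0, h0, hz, ?_⟩, hA, hB, isEmpty_algEquiv_of_isSemisimpleRing hA hB⟩
    rw [inv_inv, ← neg_sub]
    exact neg_ne_zero.2 hz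
  have hlin : ∀ s q : ℂ, s ^ 2 = Complex.I → q = Complex.I * s →
      QBrauerParam q⁻¹ q ∧ q - q⁻¹ ≠ 0 ∧ IsSemisimpleRing (QBrauer 3 q⁻¹ q) ∧
        ¬ IsSemisimpleRing (BMW 3 q⁻¹ q) ∧ IsEmpty (QBrauer 3 q⁻¹ q ≃ₐ[ℂ] BMW 3 q⁻¹ q) := by
    intro s q hs hqs
    -- Both complex examples thus use the same values of `q`, and the same BMW algebra.
    have hq : q ^ 2 = -Complex.I := by rw [hqs, mul_pow, Complex.I_sq, hs, neg_one_mul]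
    obtain ⟨h0, hz, -, h1⟩ := Complex.ne_of_sq_eq_neg_I hq
    have hA := QBrauer.isSemisimpleRing_three hq
    have hB := BMW.not_isSemisimpleRing_three hq
    refine ⟨⟨inv_ne_zero h0, h0, h1, fun h => h1 ?_⟩, hz, hA, hB,
      isEmpty_algEquiv_of_isSemisimpleRing hA hB⟩
    rw [sub_eq_zero, inv_eq_one] at h
    rw [h, sub_self]
  have hbmw : {p : ZMod 5 × ZMod 5 | p.1 ≠ 0 ∧ p.2 ≠ 0 ∧ ¬ IsSemisimpleRing (BMW 2 p.1 p.2)} =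
      (({1, 2, 3, 4} : Set (ZMod 5)) ×ˢ ({2, 3} : Set (ZMod 5))) ∪
        (({1, 4} : Set (ZMod 5)) ×ˢ ({1, 4} : Set (ZMod 5))) := by
    ext ⟨r, q⟩
    have key : ∀ r q : ZMod 5,
        (r ≠ 0 ∧ q ≠ 0 ∧ ((q = 2 ∨ q = 3) ∨ (r = 1 ∨ r = 4) ∧ (q = 1 ∨ q = 4))) ↔
          (r = 1 ∨ r = 2 ∨ r = 3 ∨ r = 4) ∧ (q = 2 ∨ q = 3) ∨
            (r = 1 ∨ r = 4) ∧ (q = 1 ∨ q = 4) := by decide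
    refine Iff.trans ?_ (key r q)
    exact and_congr_right fun hr => and_congr_right fun hq => BMW.not_isSemisimpleRing_two_iff hr hq
  have hbmw' : {p : ZMod 5 × ZMod 5 | p.1 ≠ 0 ∧ p.2 ≠ 0 ∧ p.2 - p.2⁻¹ ≠ 0 ∧
      ¬ IsSemisimpleRing (BMW 2 p.1 p.2)} =
      ({1, 2, 3, 4} : Set (ZMod 5)) ×ˢ ({2, 3} : Set (ZMod 5)) := by
    ext ⟨r, q⟩
    have key : ∀ r q : ZMod 5,
        (r ≠ 0 ∧ q ≠ 0 ∧ q - q⁻¹ ≠ 0 ∧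
          ((q = 2 ∨ q = 3) ∨ (r = 1 ∨ r = 4) ∧ (q = 1 ∨ q = 4))) ↔
          (r = 1 ∨ r = 2 ∨ r = 3 ∨ r = 4) ∧ (q = 2 ∨ q = 3) := by
      simp only [zmod_five_inv]
      decide
    refine Iff.trans ?_ (key r q)
    exact and_congr_right fun hr => and_congr_right fun hq => and_congr_right fun _ =>
      BMW.not_isSemisimpleRing_two_iff hr hq
  have hbrsq : {p : ZMod 5 × ZMod 5 |
      QBrauerSqParam p.1 p.2 ∧ ¬ IsSemisimpleRing (QBrauerSq 2 p.1 p.2)} =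
      ({2, 3} : Set (ZMod 5)) ×ˢ ({2, 3} : Set (ZMod 5)) := by
    ext ⟨r, q⟩
    exact QBrauerSq.not_isSemisimpleRing_two_iff
  have hbr : {p : ZMod 5 × ZMod 5 |
      QBrauerParam p.1 p.2 ∧ ¬ IsSemisimpleRing (QBrauer 2 p.1 p.2)} =
      ({2, 3, 4} : Set (ZMod 5)) ×ˢ ({4} : Set (ZMod 5)) := by
    ext ⟨r, q⟩
    exact QBrauer.not_isSemisimpleRing_two_iff
  refine ⟨fun h => ?_, fun h => ?_, hsq, hlin, hbmw, hbrsq, hbr, ?_, ?_, ?_, ?_⟩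
  · obtain ⟨q, hq⟩ := IsAlgClosed.exists_pow_nat_eq (-Complex.I) (n := 2) (by norm_num)
    obtain ⟨hp, -, -, he⟩ := hsq q hq
    obtain ⟨f⟩ := h 3 ℂ q⁻¹ q (by norm_num) hp
    exact he.false f
  · obtain ⟨s, hs⟩ := IsAlgClosed.exists_pow_nat_eq Complex.I (n := 2) (by norm_num)
    obtain ⟨hp, hz, -, -, he⟩ := hlin s _ hs rfl
    obtain ⟨f⟩ := h 3 ℂ _ _ (by norm_num) hp hz
    exact he.false f
  · rw [hbmw, Set.ncard_eq_toFinset_card']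
    decide
  · rw [hbmw', Set.ncard_eq_toFinset_card']
    decide
  · rw [hbrsq, Set.ncard_eq_toFinset_card']
    decide
  · rw [hbr, Set.ncard_eq_toFinset_card']
    decide
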